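/- Let $(\Omega,\mathcal F,\mathbb P)$ be a probability space, $\theta:\Omega\to\Omega$ an invertible, bi-measurable, measure-preserving and ergodic transformation, $d\in\mathbb N$, and let $\phi:\omega\mapsto\phi_\omega$ be a random quantum channel, i.e. a measurable map into the completely positive trace-preserving linear maps on $\mathbb M_d=M_d(\mathbb C)$. Put $\phi_{n;\omega}=\phi_{\theta^n(\omega)}$ for $n\in\mathbb Z$, and $\Phi_N=\phi_N\circ\cdots\circ\phi_1$ for $N>0$, $\Phi_N=\phi_0\circ\phi_{-1}\circ\cdots\circ\phi_N$ for $N\le 0$. Random matrices are identified when they agree almost surely, and $\langle A,B\rangle=\operatorname{Tr}(A^*B)$. A random orthogonal projection $P$ is called \emph{reducing} if there is a random constant $C>0$ such that, for every $N\ge 1$, $\Phi_N(P)\le C\,(P\circ\theta^N)$ almost surely. It is a \emph{minimal reducing projection} if it is a minimal element, for the almost sure order $\le$, of the set of reducing projections that are not almost surely $0$. Then the limit \[ \mathfrak E(I)=\lim_{M\to\infty}\frac1M\sum_{N=0}^{M-1}\Phi_{-N}(I) \] exists almost surely. Let $P_{\mathrm r}$ be the orthogonal projection onto the range of $\mathfrak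 E(I)$ (the \emph{recurrent projection}) and $P_{\mathrm t}=I-P_{\mathrm r}$ (the \emph{transient projection}). The following hold. (1) There are finitely many minimal reducing projections $Q_1,\dots,Q_m$ such that $Q_iQ_j=Q_jQ_i=0$ almost surely for all $i\ne j$ and $\sum_{i=1}^m Q_i=P_{\mathrm r}$ almost surely. (2) For every random matrix $Y$ with essentially bounded operator norm such that $P_{\mathrm t}YP_{\mathrm t}=Y$ almost surely, and for every random state $\vartheta$ (a random matrix with $\vartheta\ge 0$ and $\operatorname{Tr}\vartheta=1$ almost surely), \[ \lim_{M\to\infty}\frac1M\sum_{N=0}^{M-1}\mathbb E\big\langle\Phi_N(\vartheta),\,Y\circ\theta^{N}\big\rangle=0 . \] -/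

import Mathlib

open MeasureTheory Filter Topology
open scoped ENNReal MatrixOrder Matrix.Norms.L2Operator CStarAlgebra

noncomputable section

namespace RepeatedInteraction

/-- `d × d` complex matrices. In this file they carry the Loewner order and, as a norm, the operator
norm on `ℂ^d` (the topology is the usual one). -/
abbrev Mat (d : ℕ) : Type := Matrix (Fin d) (Fin d) ℂ

/-- A quantum channel: a completely positive, trace-preserving linear map on `d × d` matrices. -/
structure QuantumChannel (d : ℕ) extends CompletelyPositiveMap (Mat d) (Mat d) where
  trace_preserving : ∀ X : Mat d, (toLinearMap X).trace = X.trace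

/-- The Hilbert-Schmidt inner product `⟨A, B⟩ = Tr (A* B)`. -/
def hsInner {d : ℕ} (A B : Mat d) : ℂ := (Matrix.conjTranspose A * B).trace

/-- The orthogonal projection of `ℂ^d` onto the range of `A`, as a matrix. -/
def rangeProj {d : ℕ} (A : Mat d) : Mat d :=
  (Matrix.toEuclideanCLM (n := Fin d) (𝕜 := ℂ)).symm
    (LinearMap.range (Matrix.toEuclideanCLM (n := Fin d) (𝕜 := ℂ) A).toLinearMap).starProjection

/-- An ergodic repeated interaction quantum system: an invertible ergodic measure-preserving
transformation `θ` together with a random quantum channel `φ`. -/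
structure ERIS (Ω : Type*) [MeasurableSpace Ω] (μ : Measure Ω) (d : ℕ) where
  θ : Ω ≃ᵐ Ω
  ergodic : Ergodic θ μ
  φ : Ω → QuantumChannel d
  measurable_φ : ∀ X : Mat d, AEStronglyMeasurable (fun ω => (φ ω).toLinearMap X) μ

variable {Ω : Type*} [MeasurableSpace Ω] {μ : Measure Ω} {d : ℕ}

namespace ERIS

/-- The map `θ ^ n` for an integer `n`. -/
def shift (Q : ERIS Ω μ d) (n : ℤ) : Ω → Ω := ⇑((Q.θ.toEquiv : Equiv.Perm Ω) ^ n)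

/-- The random channel `φ_n = φ ∘ θ ^ n`, as a linear map. -/
def channel (Q : ERIS Ω μ d) (n : ℤ) (ω : Ω) : Mat d →ₗ[ℂ] Mat d :=
  (Q.φ (Q.shift n ω)).toLinearMap

/-- `φ_N ∘ ⋯ ∘ φ_1` (the identity for `N = 0`). -/
def forward (Q : ERIS Ω μ d) : ℕ → Ω → (Mat d →ₗ[ℂ] Mat d)
  | 0, _ => LinearMap.id
  | N + 1, ω => Q.channel (N + 1) ω ∘ₗ Q.forward N ω

/-- `φ_0 ∘ φ_{-1} ∘ ⋯ ∘ φ_{-N}`. -/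
def backward (Q : ERIS Ω μ d) : ℕ → Ω → (Mat d →ₗ[ℂ] Mat d)
  | 0, ω => Q.channel 0 ω
  | N + 1, ω => Q.backward N ω ∘ₗ Q.channel (-(N + 1)) ω

/-- `Φ_N = φ_N ∘ ⋯ ∘ φ_1` for `N > 0` and `Φ_N = φ_0 ∘ ⋯ ∘ φ_N` for `N ≤ 0`. -/
def Phi (Q : ERIS Ω μ d) (N : ℤ) (ω : Ω) : Mat d →ₗ[ℂ] Mat d :=
  if 0 < N then Q.forward N.toNat ω else Q.backward (-N).toNat ω

/-- The averages `(1/M) ∑_{N < M} Φ_{-N}(I)`. -/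
def cesaroAvgOne (Q : ERIS Ω μ d) (M : ℕ) (ω : Ω) : Mat d :=
  (M : ℝ)⁻¹ • ∑ N ∈ Finset.range M, Q.Phi (-(N : ℤ)) ω 1

/-- The pointwise limit `𝔈(I)` of the averages `(1/M) ∑_{N < M} Φ_{-N}(I)`. -/
def cesaroLimitOne (Q : ERIS Ω μ d) (ω : Ω) : Mat d :=
  limUnder atTop (fun M : ℕ => Q.cesaroAvgOne M ω)

/-- The recurrent projection, the range projection of `𝔈(I)`. -/
def recurrentProj (Q : ERIS Ω μ d) (ω : Ω) : Mat d := rangeProj (Q.cesaroLimitOne ω)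

/-- The transient projection. -/
def transientProj (Q : ERIS Ω μ d) (ω : Ω) : Mat d := 1 - Q.recurrentProj ω

end ERIS

/-- A random orthogonal projection. -/
def IsRandomProjection (μ : Measure Ω) (P : Ω → Mat d) : Prop :=
  AEStronglyMeasurable P μ ∧ ∀ᵐ ω ∂μ, IsStarProjection (P ω)

/-- A random state: almost surely positive of trace one. -/
def IsRandomState (μ : Measure Ω) (ϑ : Ω → Mat d) : Prop :=
  AEStronglyMeasurable ϑ μ ∧ ∀ᵐ ω ∂μ, 0 ≤ ϑ ω ∧ (ϑ ω).trace = 1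

/-- Membership in the corner `P 𝔄 P` of the algebra `𝔄` of random matrices with essentially bounded
operator norm. -/
def InCorner (μ : Measure Ω) (P Y : Ω → Mat d) : Prop :=
  MemLp Y ∞ μ ∧ ∀ᵐ ω ∂μ, P ω * Y ω * P ω = Y ω

/-- The random projection `P` reduces `Q`: there is a random constant `C > 0` such that, for all
`N ≥ 1`, `Φ_N(P) ≤ C (P ∘ θ ^ N)` almost surely. -/
def Reduces (Q : ERIS Ω μ d) (P : Ω → Mat d) : Prop :=
  IsRandomProjection μ P ∧
    ∃ C : Ω → ℝ, AEMeasurable C μ ∧ (∀ᵐ ω ∂μ, 0 < C ω) ∧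
      ∀ N : ℕ, 1 ≤ N → ∀ᵐ ω ∂μ, Q.Phi N ω (P ω) ≤ C ω • P (Q.shift N ω)

/-- `P` is a minimal element of the set of nonzero reducing projections; random matrices are
identified when they agree almost surely, and the order is the almost sure Loewner order. -/
def IsMinimalReducing (Q : ERIS Ω μ d) (P : Ω → Mat d) : Prop :=
  (Reduces Q P ∧ ¬ (∀ᵐ ω ∂μ, P ω = 0)) ∧
    ∀ P' : Ω → Mat d, Reduces Q P' → ¬ (∀ᵐ ω ∂μ, P' ω = 0) →
      (∀ᵐ ω ∂μ, P' ω ≤ P ω) → ∀ᵐ ω ∂μ, P' ω = P ω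

end RepeatedInteraction

end

/-! Everything is read off one operator on random matrices, `(L F)(ω) = φ_ω(F(θ⁻¹ω))` (`evolve`).
Then `Φ_{-N}(I) = L^{N+1} I`, and `Φ_N(F)(ω) = (L^N F)(θ^N ω)` for `N ≥ 1`. The iterates of `L` act
fibrewise by positive trace-preserving maps, so they are uniformly bounded (factor `6d`) and the
pointwise ergodic theorem for bounded cocycles applies. Its proof is the classical one: the mean
ergodic theorem writes `F` as a fixed vector plus a coboundary `Z - L Z` plus an error that is small
in `L²`, and the maximal inequality controls the averages of the error. The limit `𝔈(I)` satisfies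
`L 𝔈(I) = 𝔈(I)`.

For (1), `P` is reducing exactly when one step of `L` keeps it under itself (`reduces_iff`). The
main point is `Reduces.sub`: for reducing `R ≤ S ≤ P_r`, the difference `S - R` is reducing. Indeed
`h = Tr(𝔈(I)(1 - R))` satisfies `h ≤ h ∘ θ⁻¹` and both sides have the same integral, so they agree;
thus no weight of `𝔈(I)` leaks into `R`, and neither does weight of anything below its range
projection. By ergodicity a nonzero reducing projection is almost never zero, so by traces `P_r` is
a sum of at most `d` of them. In a sum with the largest number of terms each term is minimal, since
otherwise it could be split.

For (2), `ϑ ≤ 1` bounds the `N`-th correlation, `N ≥ 1`, by a constant times `E Tr(L^N I · P_t)`.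
The averages of these weights tend to `E Tr(𝔈(I) P_t) = 0` by dominated convergence. -/

namespace RepeatedInteraction

/-! ### The maximal ergodic inequality -/

section MaximalInequality

variable {Ω : Type*}

/-- The running maximum of the Birkhoff sums of `g`, started at `0`. -/
noncomputable def runningMax (τ : Ω → Ω) (g : Ω → ℝ) : ℕ → Ω → ℝ
  | 0, _ => 0
  | n + 1, ω => max 0 (g ω + runningMax τ g n (τ ω))

theorem runningMax_nonneg (τ : Ω → Ω) (g : Ω → ℝ) (n : ℕ) (ω : Ω) : 0 ≤ runningMax τ g n ω := by
  cases n with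
  | zero => exact le_rfl
  | succ n => exact le_max_left _ _

theorem runningMax_le_succ (τ : Ω → Ω) (g : Ω → ℝ) (n : ℕ) (ω : Ω) :
    runningMax τ g n ω ≤ runningMax τ g (n + 1) ω := by
  induction n generalizing ω with
  | zero => exact runningMax_nonneg _ _ _ _
  | succ n ih =>
    simp only [runningMax] at ih ⊢
    exact max_le_max le_rfl (by linarith [ih (τ ω)])

theorem birkhoffSum_le_runningMax (τ : Ω → Ω) (g : Ω → ℝ) (n : ℕ) (ω : Ω) :
    birkhoffSum τ g n ω ≤ runningMax τ g n ω := by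
  induction n generalizing ω with
  | zero => simp [runningMax]
  | succ n ih =>
    rw [birkhoffSum_succ']
    exact le_max_of_le_right (by linarith [ih (τ ω)])

variable [MeasurableSpace Ω] {μ : Measure Ω}

theorem integrable_runningMax {τ : Ω → Ω} (hτ : MeasurePreserving τ μ μ) {g : Ω → ℝ}
    (hg : Integrable g μ) (n : ℕ) : Integrable (runningMax τ g n) μ := by
  induction n with
  | zero => exact integrable_zero _ _ _
  | succ n ih =>
    exact (integrable_zero Ω ℝ μ).sup (hg.add (hτ.integrable_comp_of_integrable ih))

/-- **Maximal ergodic inequality** for nonnegative functions. -/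
theorem measure_exists_birkhoffSum_gt_le [IsProbabilityMeasure μ] {τ : Ω → Ω}
    (hτ : MeasurePreserving τ μ μ) {f : Ω → ℝ} (hf : Integrable f μ) (hf0 : ∀ ω, 0 ≤ f ω)
    {c : ℝ} (hc : 0 < c) :
    μ {ω | ∃ n : ℕ, n * c < birkhoffSum τ f n ω} ≤ ENNReal.ofReal ((∫ ω, f ω ∂μ) / c) := by
  set g : Ω → ℝ := fun ω => f ω - c with hg_def
  have hg : Integrable g μ := hf.sub (integrable_const c)
  have hsub : {ω | ∃ n : ℕ, n * c < birkhoffSum τ f n ω} ⊆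
      ⋃ n, {ω | 0 < runningMax τ g n ω} := by
    rintro ω ⟨n, hn⟩
    refine Set.mem_iUnion.2 ⟨n, ?_⟩
    refine lt_of_lt_of_le ?_ (birkhoffSum_le_runningMax τ g n ω)
    have : birkhoffSum τ g n ω = birkhoffSum τ f n ω - n * c := by
      simp [birkhoffSum, hg_def, Finset.sum_sub_distrib]
    linarith
  have hmono : Monotone fun n => {ω | 0 < runningMax τ g n ω} :=
    monotone_nat_of_le_succ fun n ω (h : 0 < _) => lt_of_lt_of_le h (runningMax_le_succ τ g n ω)
  refine (measure_mono hsub).trans ?_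
  rw [hmono.measure_iUnion]
  refine iSup_le fun n => ?_
  set m := runningMax τ g (n + 1) with hm_def
  have hm : Integrable m μ := integrable_runningMax hτ hg _
  have hmτ : Integrable (fun ω => m (τ ω)) μ := hτ.integrable_comp_of_integrable hm
  -- Adding the coboundary `m ∘ τ - m` does not change the integral. The new function is still
  -- nonnegative, and it is at least `c` wherever `m > 0`, so Markov's inequality finishes.
  set h : Ω → ℝ := fun ω => f ω + (m (τ ω) - m ω) with hh_def
  have key : ∀ ω, (0 < m ω → c ≤ h ω) ∧ 0 ≤ h ω := by
    intro ω
    have h1 : m ω = max 0 (g ω + runningMax τ g n (τ ω)) := rfl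
    have h2 : runningMax τ g n (τ ω) ≤ m (τ ω) := runningMax_le_succ τ g n _
    have h3 : 0 ≤ m (τ ω) := runningMax_nonneg τ g _ _
    have h4 := hf0 ω
    have h5 : 0 < m ω → c ≤ h ω := by
      intro hpos
      rw [h1] at hpos
      have h6 : m ω = g ω + runningMax τ g n (τ ω) := by
        rw [h1]
        exact max_eq_right (by rcases lt_max_iff.1 hpos with h | h <;> linarith)
      simp only [hh_def, h6, hg_def]
      linarith
    refine ⟨h5, ?_⟩
    rcases (runningMax_nonneg τ g (n + 1) ω).eq_or_lt with h6 | h6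
    · simp only [hh_def]
      rw [← hm_def] at h6
      linarith
    · linarith [h5 h6]
  have hmark := mul_meas_ge_le_integral_of_nonneg (μ := μ) (f := h)
    (ae_of_all _ fun ω => (key ω).2) (hf.add (hmτ.sub hm)) c
  have h_int : ∫ ω, h ω ∂μ = ∫ ω, f ω ∂μ := by
    have h1 : ∫ ω, m (τ ω) ∂μ = ∫ ω, m ω ∂μ := by
      have h2 := integral_map hτ.aemeasurable (f := m) (by rw [hτ.map_eq]; exact hm.1)
      rw [hτ.map_eq] at h2
      exact h2.symm
    have h3 : ∫ ω, (m (τ ω) - m ω) ∂μ = 0 := by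
      rw [integral_sub hmτ hm, h1, sub_self]
    simp only [hh_def]
    rw [integral_add hf (g := fun ω => m (τ ω) - m ω) (hmτ.sub hm), h3, add_zero]
  calc μ {ω | 0 < runningMax τ g n ω} ≤ μ {ω | c ≤ h ω} :=
        measure_mono fun ω (hω : 0 < _) =>
          (key ω).1 (lt_of_lt_of_le hω (runningMax_le_succ τ g n ω))
    _ = ENNReal.ofReal (μ.real {ω | c ≤ h ω}) := by
        rw [Measure.real, ENNReal.ofReal_toReal (measure_ne_top _ _)]
    _ ≤ _ := by
        refine ENNReal.ofReal_le_ofReal ?_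
        rw [le_div_iff₀ hc, ← h_int, mul_comm]
        exact hmark

end MaximalInequality

/-! ### The mean ergodic splitting for power-bounded operators -/

section MeanErgodic

variable {H : Type*} [NormedAddCommGroup H] [InnerProductSpace ℂ H] [CompleteSpace H]

/-- The mean ergodic decomposition for a power-bounded operator on a Hilbert space. -/
theorem exists_fixed_sub_mem_closure_range (L : H →L[ℂ] H) {K : ℝ}
    (hK : ∀ (n : ℕ) (x : H), ‖(L ^ n) x‖ ≤ K * ‖x‖) (x : H) :
    ∃ y, L y = y ∧ x - y ∈ closure (Set.range fun z => z - L z) := by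
  set a : ℕ → H := fun M => ((M : ℝ) + 1)⁻¹ • ∑ n ∈ Finset.range (M + 1), (L ^ n) x with ha
  have ha_norm : ∀ M, ‖a M‖ ≤ K * ‖x‖ := by
    intro M
    have h1 : ‖∑ n ∈ Finset.range (M + 1), (L ^ n) x‖ ≤ (M + 1) * (K * ‖x‖) :=
      (norm_sum_le_of_le _ fun n _ => hK n x).trans (by simp)
    have h2 : (0 : ℝ) < (M : ℝ) + 1 := by positivity
    rw [ha, norm_smul, norm_inv, Real.norm_of_nonneg h2.le, inv_mul_le_iff₀ h2]
    exact h1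
  have ha_shift : Tendsto (fun M => L (a M) - a M) atTop (𝓝 0) := by
    have hb : ∀ M : ℕ, ‖L (a M) - a M‖ ≤ ((M : ℝ) + 1)⁻¹ * (K * ‖x‖ + ‖x‖) := by
      intro M
      have h1 : L (a M) - a M = ((M : ℝ) + 1)⁻¹ • ((L ^ (M + 1)) x - x) := by
        have h2 := Finset.sum_range_sub (fun n => (L ^ n) x) (M + 1)
        simp only [pow_zero, one_apply_eq_self, Finset.sum_sub_distrib] at h2
        rw [ha]
        simp only [ContinuousLinearMap.map_smul_of_tower, map_sum]
        rw [← smul_sub, ← h2]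
        simp [pow_succ']
      rw [h1, norm_smul, norm_inv, Real.norm_of_nonneg (by positivity)]
      gcongr
      exact (norm_sub_le _ _).trans (by gcongr; exact hK _ _)
    refine squeeze_zero_norm hb ?_
    have := tendsto_one_div_add_atTop_nhds_zero_nat (𝕜 := ℝ)
    simpa using this.mul_const (K * ‖x‖ + ‖x‖)
  -- Weak compactness by hand: the bounded scalars `⟨a M, z⟩` converge along an ultrafilter, the
  -- limit is a bounded functional of `z`, and Riesz turns it into the vector `y`.
  set U : Ultrafilter ℕ := Ultrafilter.of atTop
  have hU : (U : Filter ℕ) ≤ atTop := Ultrafilter.of_le _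
  have hlim : ∀ z : H, ∃ c : ℂ, Tendsto (fun M => inner ℂ (a M) z) U (𝓝 c) := by
    intro z
    have hb : ∀ M, inner ℂ (a M) z ∈ Metric.closedBall (0 : ℂ) (K * ‖x‖ * ‖z‖) := by
      intro M
      rw [mem_closedBall_zero_iff]
      exact (norm_inner_le_norm _ _).trans (by gcongr; exact ha_norm M)
    obtain ⟨c, -, hc⟩ := (isCompact_closedBall (0 : ℂ) (K * ‖x‖ * ‖z‖)).ultrafilter_le_nhds
      (U.map fun M => inner ℂ (a M) z)
        (le_principal_iff.2 (Ultrafilter.mem_coe.2 (Ultrafilter.mem_map.2 (univ_mem' hb))))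
    exact ⟨c, hc⟩
  choose φ hφ using hlim
  let φL : H →ₗ[ℂ] ℂ :=
    { toFun := φ
      map_add' := fun z w => tendsto_nhds_unique (hφ (z + w))
        (((hφ z).add (hφ w)).congr fun M => (inner_add_right _ _ _).symm)
      map_smul' := fun c z => tendsto_nhds_unique (hφ (c • z))
        (((hφ z).const_mul c).congr fun M => (inner_smul_right _ _ _).symm) }
  let φC : H →L[ℂ] ℂ := φL.mkContinuous (K * ‖x‖) fun z =>
    le_of_tendsto (hφ z).norm (Eventually.of_forall fun M =>
      (norm_inner_le_norm _ _).trans (by gcongr; exact ha_norm M))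
  set y := (InnerProductSpace.toDual ℂ H).symm φC
  have hy : ∀ z, Tendsto (fun M => inner ℂ (a M) z) U (𝓝 (inner ℂ y z)) := by
    intro z
    rw [InnerProductSpace.toDual_symm_apply]
    exact hφ z
  refine ⟨y, ?_, ?_⟩
  · refine ext_inner_right ℂ fun z => ?_
    rw [← ContinuousLinearMap.adjoint_inner_right]
    have h1 := hy (ContinuousLinearMap.adjoint L z)
    simp only [ContinuousLinearMap.adjoint_inner_right] at h1 ⊢
    have h2 : Tendsto (fun M => inner ℂ (L (a M) - a M) z) U (𝓝 (inner ℂ (0 : H) z)) :=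
      ((ha_shift.mono_left hU).inner tendsto_const_nhds)
    have h3 := h2.add (hy z)
    simp only [inner_sub_left, sub_add_cancel, inner_zero_left, zero_add] at h3
    exact tendsto_nhds_unique h1 h3
  -- The closure of the range is its double orthogonal complement. If `z` is orthogonal to the
  -- range, then `⟨a M, z⟩ = ⟨x, z⟩` for all `M`, and the limit gives `⟨y, z⟩ = ⟨x, z⟩`.
  · set R := LinearMap.range (LinearMap.id - (L : H →ₗ[ℂ] H))
    have hR : (Set.range fun z => z - L z) = (R : Set H) := by
      ext w; simp [R]
    rw [hR, ← Submodule.topologicalClosure_coe, SetLike.mem_coe,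
      ← Submodule.orthogonal_orthogonal_eq_closure, Submodule.mem_orthogonal']
    intro z hz
    have hz' : ∀ w, inner ℂ (L w) z = inner ℂ w z := by
      intro w
      have := (Submodule.mem_orthogonal _ _).1 hz (w - L w) ⟨w, rfl⟩
      rw [inner_sub_left, sub_eq_zero] at this
      exact this.symm
    have hpow : ∀ n : ℕ, inner ℂ ((L ^ n) x) z = inner ℂ x z := by
      intro n
      induction n with
      | zero => simp
      | succ n ih => rw [pow_succ', mul_apply_eq_comp, hz', ih]
    have hconst : ∀ M, inner ℂ (a M) z = inner ℂ x z := by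
      intro M
      have hM : (M : ℂ) + 1 ≠ 0 := by exact_mod_cast Nat.succ_ne_zero M
      simp only [ha]
      rw [← Complex.coe_smul, inner_smul_left, sum_inner]
      simp only [hpow]
      simp [hM]
    rw [inner_sub_left, sub_eq_zero]
    exact tendsto_nhds_unique (tendsto_const_nhds.congr fun M => (hconst M).symm) (hy z)

end MeanErgodic

/-! ### The pointwise ergodic theorem for bounded cocycles -/

section PointwiseErgodic

variable {Ω E : Type*} [NormedAddCommGroup E] [InnerProductSpace ℂ E]

/-- The transfer operator `F ↦ (ω ↦ T ω (F (τ ω)))` of a linear cocycle. -/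
def transfer {E : Type*} [AddCommGroup E] [Module ℂ E] (T : Ω → E →ₗ[ℂ] E) (τ : Ω → Ω)
    (F : Ω → E) : Ω → E :=
  fun ω => T ω (F (τ ω))

section Algebra

variable {E : Type*} [AddCommGroup E] [Module ℂ E] (T : Ω → E →ₗ[ℂ] E) (τ : Ω → Ω)

theorem transfer_iterate_add (n : ℕ) (F G : Ω → E) :
    (transfer T τ)^[n] (F + G) = (transfer T τ)^[n] F + (transfer T τ)^[n] G := by
  induction n generalizing F G with
  | zero => rfl
  | succ n ih =>
    have : transfer T τ (F + G) = transfer T τ F + transfer T τ G := by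
      ext ω; simp [transfer]
    simp only [Function.iterate_succ_apply, this, ih]

theorem transfer_iterate_sub (n : ℕ) (F G : Ω → E) :
    (transfer T τ)^[n] (F - G) = (transfer T τ)^[n] F - (transfer T τ)^[n] G := by
  have := transfer_iterate_add T τ n (F - G) G
  rw [sub_add_cancel] at this
  rw [this, add_sub_cancel_right]

end Algebra

variable [MeasurableSpace Ω] {μ : Measure Ω}

theorem transfer_congr_ae {E : Type*} [AddCommGroup E] [Module ℂ E] (T : Ω → E →ₗ[ℂ] E)
    {τ : Ω → Ω} (hτ : MeasurePreserving τ μ μ) {F G : Ω → E} (h : F =ᵐ[μ] G) :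
    transfer T τ F =ᵐ[μ] transfer T τ G := by
  filter_upwards [hτ.quasiMeasurePreserving.ae_eq_comp h] with ω hω
  simp only [Function.comp_apply] at hω
  simp only [transfer, hω]

theorem transfer_iterate_congr_ae {E : Type*} [AddCommGroup E] [Module ℂ E] (T : Ω → E →ₗ[ℂ] E)
    {τ : Ω → Ω} (hτ : MeasurePreserving τ μ μ) (n : ℕ) {F G : Ω → E} (h : F =ᵐ[μ] G) :
    (transfer T τ)^[n] F =ᵐ[μ] (transfer T τ)^[n] G := by
  induction n generalizing F G with
  | zero => exact h
  | succ n ih =>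
    simp only [Function.iterate_succ_apply]
    exact ih (transfer_congr_ae T hτ h)

/-- A uniformly bounded cocycle over a measure-preserving map induces a bounded operator on
`L²`. -/
theorem exists_transferLp {τ : Ω → Ω} (hτ : MeasurePreserving τ μ μ) {T : Ω → E →ₗ[ℂ] E}
    (hT : ∀ F : Ω → E, AEStronglyMeasurable F μ → AEStronglyMeasurable (transfer T τ F) μ)
    {K : ℝ} (hK : ∀ (ω : Ω) (x : E), ‖T ω x‖ ≤ K * ‖x‖) :
    ∃ L : Lp E 2 μ →L[ℂ] Lp E 2 μ, ∀ X, L X =ᵐ[μ] transfer T τ X := by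
  have hmem : ∀ X : Lp E 2 μ, MemLp (transfer T τ X) 2 μ := fun X =>
    MemLp.of_le_mul (c := K) ((Lp.memLp X).comp_measurePreserving hτ)
      (hT _ (Lp.aestronglyMeasurable X)) (ae_of_all _ fun ω => hK ω _)
  let L0 : Lp E 2 μ →ₗ[ℂ] Lp E 2 μ :=
    { toFun := fun X => (hmem X).toLp _
      map_add' := fun X Y => by
        rw [← MemLp.toLp_add (hmem X) (hmem Y), MemLp.toLp_eq_toLp_iff]
        refine (transfer_congr_ae T hτ (Lp.coeFn_add X Y)).trans (ae_of_all _ fun ω => ?_)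
        simp [transfer]
      map_smul' := fun c X => by
        rw [RingHom.id_apply, ← MemLp.toLp_const_smul c (hmem X), MemLp.toLp_eq_toLp_iff]
        refine (transfer_congr_ae T hτ (Lp.coeFn_smul c X)).trans (ae_of_all _ fun ω => ?_)
        simp [transfer] }
  refine ⟨L0.mkContinuous K fun X => ?_, fun X => MemLp.coeFn_toLp (hmem X)⟩
  rw [← Lp.norm_compMeasurePreserving X hτ]
  refine Lp.norm_le_mul_norm_of_ae_le_mul ?_
  filter_upwards [MemLp.coeFn_toLp (hmem X), Lp.coeFn_compMeasurePreserving X hτ] with ω h1 h2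
  change ‖(hmem X).toLp _ ω‖ ≤ _
  rw [h1, h2]
  exact hK ω _

theorem transferLp_pow {τ : Ω → Ω} (hτ : MeasurePreserving τ μ μ) {T : Ω → E →ₗ[ℂ] E}
    {L : Lp E 2 μ →L[ℂ] Lp E 2 μ} (hL : ∀ X, L X =ᵐ[μ] transfer T τ X) (n : ℕ) (X : Lp E 2 μ) :
    (L ^ n) X =ᵐ[μ] (transfer T τ)^[n] X := by
  induction n generalizing X with
  | zero => rfl
  | succ n ih =>
    rw [pow_succ, mul_apply_eq_comp, Function.iterate_succ_apply]
    exact (ih (L X)).trans (transfer_iterate_congr_ae T hτ n (hL X))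

/-- The series `∑ M⁻² ‖Z ∘ τ^M‖²` has finite integral, so its terms vanish in the limit almost
surely. This disposes of the end term of the telescoped coboundary. -/
theorem ae_tendsto_inv_mul_norm_iterate {E : Type*} [NormedAddCommGroup E] {τ : Ω → Ω}
    (hτ : MeasurePreserving τ μ μ) (Z : Lp E 2 μ) :
    ∀ᵐ ω ∂μ, Tendsto (fun M : ℕ => (M : ℝ)⁻¹ * ‖Z (τ^[M] ω)‖) atTop (𝓝 0) := by
  have hZ : AEStronglyMeasurable Z μ := Lp.aestronglyMeasurable Z
  have hfin : ∫⁻ ω, ‖Z ω‖ₑ ^ 2 ∂μ ≠ ∞ := by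
    have h1 := lintegral_rpow_enorm_lt_top_of_eLpNorm_lt_top (p := 2) (by simp) (by simp)
      (Lp.memLp Z).2
    simpa using h1.ne
  have hmeas : ∀ M : ℕ, AEMeasurable (fun ω => ‖Z (τ^[M] ω)‖ₑ ^ 2) μ := fun M =>
    ((hZ.comp_measurePreserving (hτ.iterate M)).enorm).pow_const 2
  have hM : ∀ M : ℕ, ∫⁻ ω, ‖Z (τ^[M] ω)‖ₑ ^ 2 ∂μ = ∫⁻ ω, ‖Z ω‖ₑ ^ 2 ∂μ := by
    intro M
    have h := (hτ.iterate M)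
    have h2 := lintegral_map' (μ := μ) (g := τ^[M]) (f := fun ω => ‖Z ω‖ₑ ^ 2)
      (by rw [h.map_eq]; exact hZ.enorm.pow_const 2) h.aemeasurable
    rw [h.map_eq] at h2
    exact h2.symm
  have hsum : ∫⁻ ω, ∑' M : ℕ, ENNReal.ofReal (((M : ℝ) ^ 2)⁻¹) * ‖Z (τ^[M] ω)‖ₑ ^ 2 ∂μ ≠ ∞ := by
    rw [lintegral_tsum fun M => (hmeas M).const_mul _]
    have : ∀ M : ℕ, ∫⁻ ω, ENNReal.ofReal (((M : ℝ) ^ 2)⁻¹) * ‖Z (τ^[M] ω)‖ₑ ^ 2 ∂μ =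
        ENNReal.ofReal (((M : ℝ) ^ 2)⁻¹) * ∫⁻ ω, ‖Z ω‖ₑ ^ 2 ∂μ := fun M => by
      rw [lintegral_const_mul' _ _ ENNReal.ofReal_ne_top, hM]
    simp only [this]
    rw [ENNReal.tsum_mul_right]
    refine ENNReal.mul_ne_top ?_ hfin
    exact (Real.summable_nat_pow_inv.2 one_lt_two).tsum_ofReal_ne_top
  filter_upwards [ae_lt_top' (AEMeasurable.tsum fun M => (hmeas M).const_mul _) hsum]
    with ω hω
  have h1 := ENNReal.tendsto_atTop_zero_of_tsum_ne_top hω.ne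
  have h2 : Tendsto (fun M : ℕ => ((M : ℝ)⁻¹ * ‖Z (τ^[M] ω)‖) ^ 2) atTop (𝓝 0) := by
    have h3 := (ENNReal.tendsto_toReal ENNReal.zero_ne_top).comp h1
    refine h3.congr fun M => ?_
    simp only [Function.comp_apply, ENNReal.toReal_mul, ENNReal.toReal_pow, toReal_enorm]
    rw [ENNReal.toReal_ofReal (by positivity), mul_pow, inv_pow]
  have h4 := h2.sqrt
  simp only [Real.sqrt_zero] at h4
  refine h4.congr fun M => Real.sqrt_sq (by positivity)

/-- **Pointwise ergodic theorem** for uniformly bounded linear cocycles in a Hilbert space. -/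
theorem exists_ae_tendsto_transfer_average [CompleteSpace E] [IsProbabilityMeasure μ] {τ : Ω → Ω}
    (hτ : MeasurePreserving τ μ μ) {T : Ω → E →ₗ[ℂ] E}
    (hT : ∀ F : Ω → E, AEStronglyMeasurable F μ → AEStronglyMeasurable (transfer T τ F) μ)
    {K : ℝ} (hK : ∀ (n : ℕ) (F : Ω → E) (ω : Ω), ‖(transfer T τ)^[n] F ω‖ ≤ K * ‖F (τ^[n] ω)‖)
    {F : Ω → E} (hF : MemLp F 2 μ) :
    ∃ y : Ω → E, ∀ᵐ ω ∂μ, Tendsto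
      (fun M : ℕ => (M : ℝ)⁻¹ • ∑ N ∈ Finset.range M, (transfer T τ)^[N] F ω) atTop (𝓝 (y ω)) := by
  wlog hKpos : 0 < K generalizing K
  · exact this (K := 1) (fun n F ω => (hK n F ω).trans
      (by gcongr; linarith)) one_pos
  obtain ⟨L, hL⟩ := exists_transferLp hτ hT (fun ω x => hK 1 (fun _ => x) ω)
  have hLpow : ∀ (n : ℕ) (X : Lp E 2 μ), ‖(L ^ n) X‖ ≤ K * ‖X‖ := by
    intro n X
    rw [← Lp.norm_compMeasurePreserving X (hτ.iterate n)]
    refine Lp.norm_le_mul_norm_of_ae_le_mul ?_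
    filter_upwards [transferLp_pow hτ hL n X, Lp.coeFn_compMeasurePreserving X (hτ.iterate n)]
      with ω h1 h2
    rw [h1, h2]
    exact hK n X ω
  obtain ⟨Y, hY, hcl⟩ := exists_fixed_sub_mem_closure_range L hLpow (hF.toLp F)
  refine ⟨Y, ?_⟩
  set A : ℕ → Ω → E := fun M ω => (M : ℝ)⁻¹ • ∑ N ∈ Finset.range M, (transfer T τ)^[N] F ω
  have key : ∀ c : ℝ, 0 < c → ∀ᵐ ω ∂μ, ∀ᶠ M in atTop, ‖A M ω - Y ω‖ ≤ c := by
    intro c hc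
    rw [ae_iff, ← nonpos_iff_eq_zero]
    refine le_of_forall_pos_le_add fun ε hε => ?_
    rw [zero_add]
    -- The error `W` will have `L²` norm, hence `L¹` norm, at most `δ`. The maximal inequality at
    -- level `c / (2K)` then bounds the exceptional set by `ε`; off it the averages of `W`
    -- contribute at most `c / 2`.
    obtain ⟨δ, hδ, hδε⟩ : ∃ δ : ℝ, 0 < δ ∧ ENNReal.ofReal (δ / (c / (2 * K))) ≤ ε := by
      rcases eq_or_ne ε ∞ with rfl | hεt
      · exact ⟨1, one_pos, le_top⟩
      · refine ⟨ε.toReal * (c / (2 * K)), mul_pos (ENNReal.toReal_pos hε.ne' hεt)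
          (by positivity), ?_⟩
        rw [mul_div_cancel_right₀ _ (by positivity), ENNReal.ofReal_toReal hεt]
    obtain ⟨_, ⟨Z, rfl⟩, hZ⟩ := Metric.mem_closure_iff.1 hcl δ hδ
    set W : Lp E 2 μ := hF.toLp F - Y - (Z - L Z) with hW
    rw [dist_eq_norm] at hZ
    have hdecomp : F =ᵐ[μ] ((Y : Ω → E) + ((Z : Ω → E) - transfer T τ Z)) + W := by
      filter_upwards [hF.coeFn_toLp, Lp.coeFn_sub (hF.toLp F - Y) (Z - L Z),
        Lp.coeFn_sub (hF.toLp F) Y, Lp.coeFn_sub Z (L Z), hL Z] with ω h1 h2 h3 h4 h5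
      simp only [Pi.add_apply, Pi.sub_apply]
      rw [hW, h2, Pi.sub_apply, h3, h4, Pi.sub_apply, Pi.sub_apply, h1, h5]
      abel
    have hterms : ∀ᵐ ω ∂μ, ∀ N : ℕ, (transfer T τ)^[N] F ω =
        Y ω + ((transfer T τ)^[N] Z ω - (transfer T τ)^[N + 1] Z ω) + (transfer T τ)^[N] W ω := by
      rw [ae_all_iff]
      intro N
      have hYN : (L ^ N) Y = Y := by
        induction N with
        | zero => rfl
        | succ n ih => rw [pow_succ, mul_apply_eq_comp, hY, ih]
      filter_upwards [transfer_iterate_congr_ae T hτ N hdecomp, transferLp_pow hτ hL N Y]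
        with ω h1 h2
      rw [h1, transfer_iterate_add, transfer_iterate_add, transfer_iterate_sub,
        Function.iterate_succ_apply]
      simp only [Pi.add_apply, Pi.sub_apply]
      rw [← h2, hYN]
    have hWint : Integrable (fun ω => ‖W ω‖) μ :=
      ((Lp.memLp W).integrable (by norm_num)).norm
    have hWle : ∫ ω, ‖W ω‖ ∂μ ≤ δ := by
      have h1 : ∫ ω, ‖W ω‖ ∂μ = (eLpNorm W 1 μ).toReal := by
        rw [integral_norm_eq_lintegral_enorm (Lp.aestronglyMeasurable W),
          eLpNorm_one_eq_lintegral_enorm]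
      rw [h1]
      refine le_trans ?_ hZ.le
      rw [Lp.norm_def]
      exact ENNReal.toReal_mono (Lp.eLpNorm_ne_top W)
        (eLpNorm_le_eLpNorm_of_exponent_le (by norm_num) (Lp.aestronglyMeasurable W))
    have hmax := measure_exists_birkhoffSum_gt_le hτ hWint (fun ω => norm_nonneg _)
      (c := c / (2 * K)) (by positivity)
    refine le_trans ?_ (hmax.trans ((ENNReal.ofReal_le_ofReal
      (by gcongr)).trans hδε))
    refine measure_mono_ae ?_
    filter_upwards [hterms, ae_tendsto_inv_mul_norm_iterate hτ Z] with ω h1 h2 h3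
    by_contra hno
    refine h3 ?_
    have hno' : ∀ n : ℕ, birkhoffSum τ (fun ω => ‖W ω‖) n ω ≤ n * (c / (2 * K)) := by
      intro n
      by_contra hn
      exact hno ⟨n, not_le.1 hn⟩
    have hz : Tendsto (fun M : ℕ => (M : ℝ)⁻¹ * ‖Z ω‖ + K * ((M : ℝ)⁻¹ * ‖Z (τ^[M] ω)‖))
        atTop (𝓝 0) := by
      simpa using (tendsto_inv_atTop_nhds_zero_nat (𝕜 := ℝ)).mul_const ‖Z ω‖ |>.add
        (h2.const_mul K)
    filter_upwards [hz.eventually (gt_mem_nhds (half_pos hc)), eventually_gt_atTop 0]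
      with M hM hM0
    have hM0' : (0 : ℝ) < M := by exact_mod_cast hM0
    have hA : A M ω - Y ω = (M : ℝ)⁻¹ • (Z ω - (transfer T τ)^[M] Z ω) +
        (M : ℝ)⁻¹ • ∑ N ∈ Finset.range M, (transfer T τ)^[N] W ω := by
      have ht := Finset.sum_range_sub' (fun N => (transfer T τ)^[N] Z ω) M
      simp only [A, h1]
      rw [Finset.sum_add_distrib, Finset.sum_add_distrib, ht, Finset.sum_const, Finset.card_range,
        smul_add, smul_add, ← Nat.cast_smul_eq_nsmul ℝ, smul_smul, inv_mul_cancel₀ hM0'.ne',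
        one_smul, Function.iterate_zero, id]
      abel
    have hs : ‖∑ N ∈ Finset.range M, (transfer T τ)^[N] W ω‖ ≤ K * (M * (c / (2 * K))) := by
      calc _ ≤ ∑ N ∈ Finset.range M, K * ‖W (τ^[N] ω)‖ :=
            norm_sum_le_of_le _ fun N _ => hK N W ω
        _ = K * birkhoffSum τ (fun ω => ‖W ω‖) M ω := by
            rw [birkhoffSum, Finset.mul_sum]
        _ ≤ _ := by gcongr; exact hno' M
    have hs' : (M : ℝ)⁻¹ * (K * (M * (c / (2 * K)))) = c / 2 := by
      field_simp
    rw [hA]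
    calc _ ≤ (M : ℝ)⁻¹ * (‖Z ω‖ + K * ‖Z (τ^[M] ω)‖) + (M : ℝ)⁻¹ * (K * (M * (c / (2 * K)))) := by
          refine (norm_add_le _ _).trans ?_
          rw [norm_smul, norm_smul, norm_inv, Real.norm_of_nonneg hM0'.le]
          gcongr
          exact (norm_sub_le _ _).trans (by gcongr; exact hK M Z ω)
      _ ≤ c := by
          rw [hs']
          have : (M : ℝ)⁻¹ * (‖Z ω‖ + K * ‖Z (τ^[M] ω)‖) =
            (M : ℝ)⁻¹ * ‖Z ω‖ + K * ((M : ℝ)⁻¹ * ‖Z (τ^[M] ω)‖) := by ring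
          linarith
  have hall : ∀ᵐ ω ∂μ, ∀ k : ℕ, ∀ᶠ M in atTop, ‖A M ω - Y ω‖ ≤ 1 / ((k : ℝ) + 1) :=
    ae_all_iff.2 fun k => key _ (by positivity)
  filter_upwards [hall] with ω hω
  rw [Metric.tendsto_nhds]
  intro ε hε
  obtain ⟨k, hk⟩ := exists_nat_one_div_lt hε
  filter_upwards [hω k] with M hM
  rw [dist_eq_norm]
  exact hM.trans_lt hk

end PointwiseErgodic

/-! ### Positive matrices and traces -/

section Matrices
open scoped ComplexOrder

variable {d : ℕ}

theorem trace_re_nonneg {A : Mat d} (hA : 0 ≤ A) : 0 ≤ A.trace.re :=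
  (Complex.le_def.1 (Matrix.nonneg_iff_posSemidef.1 hA).trace_nonneg).1

theorem trace_re_mono {A B : Mat d} (h : A ≤ B) : A.trace.re ≤ B.trace.re := by
  have := trace_re_nonneg (sub_nonneg.2 h)
  rw [Matrix.trace_sub, Complex.sub_re] at this
  linarith

theorem exists_eq_star_mul_self {A : Mat d} (hA : 0 ≤ A) : ∃ B : Mat d, A = star B * B :=
  CStarAlgebra.nonneg_iff_eq_star_mul_self.1 hA

theorem trace_mul_nonneg {A B : Mat d} (hA : 0 ≤ A) (hB : 0 ≤ B) : 0 ≤ (A * B).trace := by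
  obtain ⟨C, rfl⟩ := exists_eq_star_mul_self hA
  rw [mul_assoc, Matrix.trace_mul_comm, mul_assoc]
  have h := star_right_conjugate_nonneg hB C
  rw [mul_assoc] at h
  exact (Matrix.nonneg_iff_posSemidef.1 h).trace_nonneg

theorem trace_mul_re_nonneg {A B : Mat d} (hA : 0 ≤ A) (hB : 0 ≤ B) : 0 ≤ (A * B).trace.re :=
  (Complex.le_def.1 (trace_mul_nonneg hA hB)).1

theorem trace_mul_re_mono_left {A A' B : Mat d} (h : A ≤ A') (hB : 0 ≤ B) :
    (A * B).trace.re ≤ (A' * B).trace.re := by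
  have := trace_mul_re_nonneg (sub_nonneg.2 h) hB
  rw [sub_mul, Matrix.trace_sub, Complex.sub_re] at this
  linarith

theorem trace_mul_re_mono_right {A B B' : Mat d} (hA : 0 ≤ A) (h : B ≤ B') :
    (A * B).trace.re ≤ (A * B').trace.re := by
  rw [Matrix.trace_mul_comm A, Matrix.trace_mul_comm A]
  exact trace_mul_re_mono_left h hA

/-- With `A = C*C` and `B = D*D`, the trace of `AB` is the squared Hilbert-Schmidt norm of `D C*`.
-/
theorem mul_eq_zero_of_trace_re {A B : Mat d} (hA : 0 ≤ A) (hB : 0 ≤ B)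
    (h : (A * B).trace.re = 0) : A * B = 0 := by
  have h0 : (A * B).trace = 0 :=
    Complex.ext h (Complex.le_def.1 (trace_mul_nonneg hA hB)).2.symm
  obtain ⟨C, rfl⟩ := exists_eq_star_mul_self hA
  obtain ⟨D, rfl⟩ := exists_eq_star_mul_self hB
  have h1 : (star (D * star C) * (D * star C)).trace = 0 := by
    rw [← h0, star_mul, star_star]
    simp only [← mul_assoc]
    rw [Matrix.trace_mul_comm, ← mul_assoc, ← mul_assoc]
  have h2 : D * star C = 0 := Matrix.trace_conjTranspose_mul_self_eq_zero_iff.1 h1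
  have h3 : C * star D = 0 := by
    have := congrArg star h2
    simpa using this
  rw [mul_assoc, ← mul_assoc C, h3]
  simp

theorem mul_comm_eq_zero {A B : Mat d} (hA : 0 ≤ A) (hB : 0 ≤ B) (h : A * B = 0) : B * A = 0 := by
  have := congrArg star h
  rwa [star_mul, star_zero, (IsSelfAdjoint.of_nonneg hA).star_eq,
    (IsSelfAdjoint.of_nonneg hB).star_eq] at this

theorem vecMulVec_trace_mul (x : Fin d → ℂ) (H : Mat d) :
    (Matrix.vecMulVec x (star x) * H).trace = star x ⬝ᵥ (H.mulVec x) := by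
  rw [Matrix.trace_mul_comm, Matrix.mul_vecMulVec, Matrix.trace_vecMulVec, dotProduct_comm]

theorem norm_le_trace_re {A : Mat d} (hA : 0 ≤ A) : ‖A‖ ≤ A.trace.re := by
  have hps := Matrix.nonneg_iff_posSemidef.1 hA
  have htr : A.trace.re = ∑ i, hps.1.eigenvalues i := by
    have := hps.1.trace_eq_sum_eigenvalues
    rw [this]
    simp
  rw [CStarAlgebra.norm_le_iff_le_algebraMap A (trace_re_nonneg hA) hA]
  rw [le_algebraMap_iff_spectrum_le (ha := IsSelfAdjoint.of_nonneg hA)]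
  intro x hx
  rw [hps.1.spectrum_real_eq_range_eigenvalues] at hx
  obtain ⟨i, rfl⟩ := hx
  rw [htr]
  exact Finset.single_le_sum (f := hps.1.eigenvalues) (fun j _ => hps.eigenvalues_nonneg j)
    (Finset.mem_univ i)

theorem le_trace_re_smul_one {A : Mat d} (hA : 0 ≤ A) : A ≤ A.trace.re • (1 : Mat d) := by
  have := (CStarAlgebra.norm_le_iff_le_algebraMap A (trace_re_nonneg hA) hA).1 (norm_le_trace_re hA)
  rwa [Algebra.algebraMap_eq_smul_one] at this

/-- No weight outside `P` forces `A = P A P`; compress `A ≤ Tr(A) · 1` by `P`. -/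
theorem le_trace_smul_proj {A P : Mat d} (hA : 0 ≤ A) (hP : IsStarProjection P)
    (h : (A * (1 - P)).trace.re = 0) : A ≤ A.trace.re • P := by
  have h1 := mul_eq_zero_of_trace_re hA hP.one_sub.nonneg h
  have h2 := mul_comm_eq_zero hA hP.one_sub.nonneg h1
  have h3 : A * P = A := by
    rw [mul_sub, mul_one, sub_eq_zero] at h1
    exact h1.symm
  have h4 : P * A = A := by
    rw [sub_mul, one_mul, sub_eq_zero] at h2
    exact h2.symm
  have h5 := star_right_conjugate_le_conjugate (le_trace_re_smul_one hA) P
  rwa [hP.isSelfAdjoint.star_eq, h4, h3, mul_smul_comm, mul_one, smul_mul_assoc,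
    hP.isIdempotentElem.eq] at h5

theorem proj_trace_re_le {P : Mat d} (hP : IsStarProjection P) : P.trace.re ≤ d := by
  have := trace_re_mono (sub_nonneg.1 hP.one_sub.nonneg)
  simpa using this

/-! ### Positive trace-preserving maps and positive functionals -/

/-- A linear map on matrices that is positive and preserves the trace. -/
structure IsPosTracePreserving (Ψ : Mat d →ₗ[ℂ] Mat d) : Prop where
  nonneg : ∀ A : Mat d, 0 ≤ A → 0 ≤ Ψ A
  trace_eq : ∀ A : Mat d, (Ψ A).trace = A.trace

namespace IsPosTracePreserving

theorem id : IsPosTracePreserving (LinearMap.id : Mat d →ₗ[ℂ] Mat d) :=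
  ⟨fun _ h => h, fun _ => rfl⟩

theorem comp {Ψ Ψ' : Mat d →ₗ[ℂ] Mat d} (h : IsPosTracePreserving Ψ)
    (h' : IsPosTracePreserving Ψ') : IsPosTracePreserving (Ψ ∘ₗ Ψ') :=
  ⟨fun A hA => h.nonneg _ (h'.nonneg A hA), fun A => (h.trace_eq _).trans (h'.trace_eq A)⟩

theorem mono {Ψ : Mat d →ₗ[ℂ] Mat d} (h : IsPosTracePreserving Ψ) {A B : Mat d} (hAB : A ≤ B) :
    Ψ A ≤ Ψ B := by
  have := h.nonneg _ (sub_nonneg.2 hAB)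
  rwa [map_sub, sub_nonneg] at this

/-- The shift `A + ‖A‖ · 1` lies between `0` and `2‖A‖ · 1`, and `‖Ψ 1‖ ≤ Tr 1 = d`. The shifted
matrix costs `2d‖A‖` and undoing the shift costs `d‖A‖`. -/
theorem norm_apply_le_of_selfAdjoint {Ψ : Mat d →ₗ[ℂ] Mat d} (h : IsPosTracePreserving Ψ)
    {A : Mat d} (hA : IsSelfAdjoint A) : ‖Ψ A‖ ≤ 3 * d * ‖A‖ := by
  have h1 : ‖Ψ 1‖ ≤ d := by
    refine (norm_le_trace_re (h.nonneg _ zero_le_one)).trans ?_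
    rw [h.trace_eq]
    simp
  have hpos : 0 ≤ A + ‖A‖ • (1 : Mat d) := by
    have := hA.neg_algebraMap_norm_le_self
    rw [Algebra.algebraMap_eq_smul_one] at this
    have h3 := sub_nonneg.2 this
    rwa [sub_neg_eq_add] at h3
  have hle : A + ‖A‖ • (1 : Mat d) ≤ (2 * ‖A‖) • (1 : Mat d) := by
    have := hA.le_algebraMap_norm_self
    rw [Algebra.algebraMap_eq_smul_one] at this
    rw [two_mul, add_smul]
    gcongr
  have hsm : ∀ r : ℝ, Ψ (r • (1 : Mat d)) = r • Ψ 1 := fun r => by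
    rw [← Complex.coe_smul, map_smul, Complex.coe_smul]
  have h2 : ‖Ψ (A + ‖A‖ • (1 : Mat d))‖ ≤ 2 * ‖A‖ * d := by
    refine (CStarAlgebra.norm_le_norm_of_nonneg_of_le (h.nonneg _ hpos) (h.mono hle)).trans ?_
    rw [hsm, norm_smul, Real.norm_of_nonneg (by positivity)]
    gcongr
  have h4 : Ψ A = Ψ (A + ‖A‖ • (1 : Mat d)) - ‖A‖ • Ψ 1 := by
    rw [map_add, hsm, add_sub_cancel_right]
  rw [h4]
  refine (norm_sub_le _ _).trans ?_
  rw [norm_smul, norm_norm]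
  nlinarith [norm_nonneg A]

theorem norm_apply_le {Ψ : Mat d →ₗ[ℂ] Mat d} (h : IsPosTracePreserving Ψ) (A : Mat d) :
    ‖Ψ A‖ ≤ 6 * d * ‖A‖ := by
  have h1 := realPart_add_I_smul_imaginaryPart A
  have h2 : Ψ A = Ψ (realPart A : Mat d) + Complex.I • Ψ (imaginaryPart A : Mat d) := by
    rw [← map_smul, ← map_add, h1]
  rw [h2]
  refine (norm_add_le _ _).trans ?_
  rw [norm_smul, Complex.norm_I, one_mul]
  have h3 := h.norm_apply_le_of_selfAdjoint (realPart A).2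
  have h4 := h.norm_apply_le_of_selfAdjoint (imaginaryPart A).2
  have h5 : ‖(realPart A : Mat d)‖ ≤ ‖A‖ := realPart.norm_le A
  have h6 : ‖(imaginaryPart A : Mat d)‖ ≤ ‖A‖ := imaginaryPart.norm_le A
  have : (0 : ℝ) ≤ 3 * d := by positivity
  nlinarith

end IsPosTracePreserving

/-- A positive linear functional on matrices is `A ↦ Tr (A H)` for a positive `H`. -/
theorem exists_density {f : Mat d →ₗ[ℂ] ℂ} (hf : ∀ A, 0 ≤ A → 0 ≤ f A) :
    ∃ H : Mat d, 0 ≤ H ∧ ∀ A, f A = (A * H).trace := by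
  -- The transposed indices make `∑ A i j * f (E_ij)` equal to `Tr(A H)`. Positivity of `H` is
  -- tested on the rank-one matrices `x x*`.
  let H : Mat d := Matrix.of fun i j => f (Matrix.single j i 1)
  have hH : ∀ A, f A = (A * H).trace := by
    intro A
    conv_lhs => rw [Matrix.matrix_eq_sum_single A]
    simp only [map_sum, Matrix.trace, Matrix.diag, Matrix.mul_apply]
    refine Finset.sum_congr rfl fun i _ => Finset.sum_congr rfl fun j _ => ?_
    have : Matrix.single i j (A i j) = A i j • Matrix.single i j (1 : ℂ) := by simp
    rw [this, map_smul, smul_eq_mul]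
    rfl
  refine ⟨H, ?_, hH⟩
  rw [Matrix.nonneg_iff_posSemidef]
  have hx : ∀ x : Fin d → ℂ, 0 ≤ star x ⬝ᵥ (H.mulVec x) := by
    intro x
    rw [← vecMulVec_trace_mul, ← hH]
    exact hf _ (Matrix.nonneg_iff_posSemidef.2 (Matrix.posSemidef_vecMulVec_self_star x))
  rw [← Matrix.isPositive_toEuclideanLin_iff, LinearMap.isPositive_iff_complex]
  intro x
  have h : inner ℂ (H.toEuclideanLin x) x = star (star x.ofLp ⬝ᵥ (H.mulVec x.ofLp)) := by
    rw [← inner_conj_symm, EuclideanSpace.inner_eq_star_dotProduct, dotProduct_comm]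
    rfl
  have h1 := Complex.le_def.1 (hx x.ofLp)
  rw [h]
  refine ⟨Complex.ext ?_ ?_, ?_⟩
  · simp
  · simpa using h1.2.symm
  · simpa using h1.1

/-! ### Range projections and leakage between corners -/

theorem toEuclideanCLM_rangeProj (A : Mat d) :
    Matrix.toEuclideanCLM (n := Fin d) (𝕜 := ℂ) (rangeProj A) =
      (LinearMap.range (Matrix.toEuclideanCLM (n := Fin d) (𝕜 := ℂ) A).toLinearMap).starProjection :=
  StarAlgEquiv.apply_symm_apply _ _

theorem rangeProj_isStarProjection (A : Mat d) : IsStarProjection (rangeProj A) := by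
  have h := isStarProjection_starProjection (U := LinearMap.range
    (Matrix.toEuclideanCLM (n := Fin d) (𝕜 := ℂ) A).toLinearMap)
  constructor
  · apply EquivLike.injective (Matrix.toEuclideanCLM (n := Fin d) (𝕜 := ℂ))
    rw [map_mul, toEuclideanCLM_rangeProj, h.isIdempotentElem.eq]
  · apply EquivLike.injective (Matrix.toEuclideanCLM (n := Fin d) (𝕜 := ℂ))
    rw [map_star, toEuclideanCLM_rangeProj, h.isSelfAdjoint.star_eq]

theorem rangeProj_mul_self (A : Mat d) : rangeProj A * A = A := by
  apply EquivLike.injective (Matrix.toEuclideanCLM (n := Fin d) (𝕜 := ℂ))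
  rw [map_mul, toEuclideanCLM_rangeProj]
  ext1 v
  rw [mul_apply_eq_comp]
  exact Submodule.starProjection_eq_self_iff.2 ⟨v, rfl⟩

theorem mul_rangeProj_eq_zero {A X : Mat d} (h : X * A = 0) : X * rangeProj A = 0 := by
  apply EquivLike.injective (Matrix.toEuclideanCLM (n := Fin d) (𝕜 := ℂ))
  rw [map_mul, toEuclideanCLM_rangeProj, map_zero]
  ext1 v
  rw [mul_apply_eq_comp]
  obtain ⟨w, hw⟩ := Submodule.starProjection_apply_mem (LinearMap.range
    (Matrix.toEuclideanCLM (n := Fin d) (𝕜 := ℂ) A).toLinearMap) v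
  rw [← hw]
  have h1 := congrArg (Matrix.toEuclideanCLM (n := Fin d) (𝕜 := ℂ)) h
  rw [map_mul, map_zero] at h1
  exact DFunLike.congr_fun h1 w

/-- The range projection of a positive matrix as a limit of polynomials in the matrix. -/
theorem tendsto_rangeProj {A : Mat d} (hA : 0 ≤ A) {K : ℝ} (hK : 0 < K)
    (hAK : A ≤ K • (1 : Mat d)) :
    Tendsto (fun n : ℕ => 1 - (n : ℂ)⁻¹ • ∑ k ∈ Finset.range n, (1 - K⁻¹ • A) ^ k) atTop
      (𝓝 (rangeProj A)) := by
  -- `B` is a contraction whose fixed vectors form `ker A = (ran A)ᗮ`, so von Neumann's theorem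
  -- sends the averages of `B ^ k` to `1 - rangeProj A`.
  set B : Mat d := 1 - K⁻¹ • A with hB
  set e := Matrix.toEuclideanCLM (n := Fin d) (𝕜 := ℂ) with he
  have hB0 : 0 ≤ B := by
    rw [hB, sub_nonneg]
    have := smul_le_smul_of_nonneg_left hAK (inv_pos.2 hK).le
    rwa [smul_smul, inv_mul_cancel₀ hK.ne', one_smul] at this
  have hB1 : ‖e B‖ ≤ 1 := by
    have : ‖B‖ ≤ 1 := by
      rw [CStarAlgebra.norm_le_one_iff_of_nonneg B hB0, hB]
      exact sub_le_self _ (smul_nonneg (inv_pos.2 hK).le hA)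
    exact this
  set S := LinearMap.range (e A).toLinearMap
  set I : EuclideanSpace ℂ (Fin d) →ₗ[ℂ] EuclideanSpace ℂ (Fin d) :=
    (1 : EuclideanSpace ℂ (Fin d) →L[ℂ] EuclideanSpace ℂ (Fin d)).toLinearMap
  have hker : (e B).eqLocus I = Sᗮ := by
    have hsa : IsSelfAdjoint (e A) := (IsSelfAdjoint.of_nonneg hA).map e
    ext v
    have h1 : v ∈ (e B).eqLocus I ↔ e A v = 0 := by
      change e B v = v ↔ _
      have h2 : e B = 1 - (K⁻¹ : ℂ) • e A := by
        rw [hB, map_sub, map_one, ← map_smul, ← Complex.coe_smul, Complex.ofReal_inv]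
      rw [h2]
      simp [sub_eq_self, hK.ne']
    rw [h1, Submodule.mem_orthogonal]
    constructor
    · rintro h _ ⟨w, rfl⟩
      change inner ℂ (e A w) v = 0
      rw [← ContinuousLinearMap.adjoint_inner_right, ← ContinuousLinearMap.star_eq_adjoint,
        hsa.star_eq, h, inner_zero_right]
    · intro h
      refine ext_inner_left ℂ fun w => ?_
      have h2 := h (e A w) ⟨w, rfl⟩
      rw [← ContinuousLinearMap.adjoint_inner_right, ← ContinuousLinearMap.star_eq_adjoint,
        hsa.star_eq] at h2
      rw [h2, inner_zero_right]
  have hconv : ∀ v, Tendsto (fun n : ℕ => e ((n : ℂ)⁻¹ • ∑ k ∈ Finset.range n, B ^ k) v) atTop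
      (𝓝 (v - e (rangeProj A) v)) := by
    intro v
    have h1 := (e B).tendsto_birkhoffAverage_orthogonalProjection hB1 v
    have h2 : (((e B).eqLocus I).orthogonalProjectionOnto v :
        EuclideanSpace ℂ (Fin d)) = v - e (rangeProj A) v := by
      rw [he, toEuclideanCLM_rangeProj, ← he]
      change _ = v - S.starProjection v
      have h3 : ((e B).eqLocus I).starProjection v =
          Sᗮ.starProjection v := by
        simp only [hker]
      change ((e B).eqLocus I).starProjection v = _
      rw [h3, Submodule.starProjection_orthogonal_val]
    rw [h2] at h1
    refine h1.congr fun n => ?_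
    simp only [birkhoffAverage, birkhoffSum, map_smul, map_sum, map_pow]
    simp
  have hmat : Tendsto (fun n : ℕ => (n : ℂ)⁻¹ • ∑ k ∈ Finset.range n, B ^ k) atTop
      (𝓝 (1 - rangeProj A)) := by
    refine tendsto_pi_nhds.2 fun i => tendsto_pi_nhds.2 fun j => ?_
    have hentry : ∀ C : Mat d, C i j = (e C (EuclideanSpace.single j 1)) i := by
      intro C
      rw [he, Matrix.ofLp_toEuclideanCLM]
      simp
    have h1 := ((EuclideanSpace.proj i : EuclideanSpace ℂ (Fin d) →L[ℂ] ℂ).continuous.tendsto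
      _).comp (hconv (EuclideanSpace.single j 1))
    rw [hentry (1 - rangeProj A), map_sub, map_one]
    refine h1.congr fun n => ?_
    exact (hentry _).symm
  simpa using hmat.const_sub 1

/-- If `H ≥ 0` is the density of `f`, then `Tr(A H) = 0` gives `H A = 0`, so `H` kills the whole
range of `A`. This passes from `𝔈(I)` to everything below `P_r`. -/
theorem functional_rangeProj_eq_zero {f : Mat d →ₗ[ℂ] ℂ} (hf : ∀ A, 0 ≤ A → 0 ≤ f A) {A : Mat d}
    (hA : 0 ≤ A) (h : f A = 0) : f (rangeProj A) = 0 := by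
  obtain ⟨H, hH0, hH⟩ := exists_density hf
  rw [hH] at h
  have h1 : A * H = 0 := mul_eq_zero_of_trace_re hA hH0 (by rw [h]; rfl)
  have h2 := mul_rangeProj_eq_zero (mul_comm_eq_zero hA hH0 h1)
  rw [hH, Matrix.trace_mul_comm, h2, Matrix.trace_zero]

/-- The functional `A ↦ Tr (Ψ(A) B)`. -/
noncomputable def traceFunctional (Ψ : Mat d →ₗ[ℂ] Mat d) (B : Mat d) : Mat d →ₗ[ℂ] ℂ :=
  Matrix.traceLinearMap (Fin d) ℂ ℂ ∘ₗ LinearMap.mulRight ℂ B ∘ₗ Ψ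

@[simp]
theorem traceFunctional_apply (Ψ : Mat d →ₗ[ℂ] Mat d) (B A : Mat d) :
    traceFunctional Ψ B A = (Ψ A * B).trace := rfl

theorem IsPosTracePreserving.traceFunctional_nonneg {Ψ : Mat d →ₗ[ℂ] Mat d}
    (h : IsPosTracePreserving Ψ) {B : Mat d} (hB : 0 ≤ B) (A : Mat d) (hA : 0 ≤ A) :
    0 ≤ traceFunctional Ψ B A :=
  trace_mul_nonneg (h.nonneg A hA) hB

theorem eq_zero_of_re_eq_zero {z : ℂ} (h : 0 ≤ z) (hre : z.re = 0) : z = 0 :=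
  Complex.ext hre (Complex.le_def.1 h).2.symm

/-- If the corner of `R'` is mapped into the corner of `R`, then the weight outside of these
corners does not increase. -/
theorem IsPosTracePreserving.trace_compl_le {Ψ : Mat d →ₗ[ℂ] Mat d} (h : IsPosTracePreserving Ψ)
    {R R' : Mat d} (hR : IsStarProjection R) (hR' : IsStarProjection R')
    (hinv : (Ψ R' * (1 - R)).trace.re = 0) {A : Mat d} (hA : 0 ≤ A) :
    (Ψ A * (1 - R)).trace ≤ (A * (1 - R')).trace := by
  have hpos := h.traceFunctional_nonneg hR.one_sub.nonneg
  obtain ⟨H, hH0, hH⟩ := exists_density hpos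
  have h0 : (R' * H).trace = 0 := by
    rw [← hH]
    exact eq_zero_of_re_eq_zero (hpos _ hR'.nonneg) hinv
  have h1 : R' * H = 0 := mul_eq_zero_of_trace_re hR'.nonneg hH0 (by rw [h0]; rfl)
  have h2 : H * R' = 0 := mul_comm_eq_zero hR'.nonneg hH0 h1
  -- The density `H` of `A ↦ Tr(Ψ(A)(1 - R))` is annihilated by `R'`, so only this compression
  -- counts; its full trace is the right-hand side.
  set A' := (1 - R') * A * (1 - R') with hA'
  have hA'0 : 0 ≤ A' := by
    have := star_right_conjugate_nonneg hA (1 - R')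
    rwa [hR'.one_sub.isSelfAdjoint.star_eq] at this
  have h3 : (Ψ A * (1 - R)).trace = (Ψ A' * (1 - R)).trace := by
    have e1 := hH A
    have e2 := hH A'
    rw [traceFunctional_apply] at e1 e2
    rw [e1, e2, hA', mul_assoc, mul_assoc, Matrix.trace_mul_comm (1 - R'), mul_assoc, mul_assoc]
    congr 2
    simp only [sub_mul, mul_sub, one_mul, mul_one, h1, h2, sub_zero]
  have h4 : (A' * (1 : Mat d)).trace = (A * (1 - R')).trace := by
    rw [mul_one, hA', mul_assoc, Matrix.trace_mul_comm, mul_assoc,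
      hR'.one_sub.isIdempotentElem.eq]
  rw [h3, ← h4, mul_one, ← h.trace_eq A']
  have h5 := trace_mul_nonneg (h.nonneg _ hA'0) hR.nonneg
  rw [mul_sub, mul_one, Matrix.trace_sub]
  exact sub_le_self _ h5

/-- If `E` loses no weight outside of the corners of `R'` and `R`, then neither does any positive
matrix below the range projection of `E`. -/
theorem IsPosTracePreserving.trace_compl_eq {Ψ : Mat d →ₗ[ℂ] Mat d} (h : IsPosTracePreserving Ψ)
    {R R' : Mat d} (hR : IsStarProjection R) (hR' : IsStarProjection R')
    (hinv : (Ψ R' * (1 - R)).trace.re = 0) {E : Mat d} (hE : 0 ≤ E)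
    (hEeq : (Ψ E * (1 - R)).trace.re = (E * (1 - R')).trace.re) {X : Mat d} (hX : 0 ≤ X)
    (hXE : X ≤ rangeProj E) :
    (Ψ X * (1 - R)).trace = (X * (1 - R')).trace := by
  -- The weight that leaks into `R` is a positive functional; it vanishes at `E`, hence at the range
  -- projection of `E`, hence at `X`.
  set g : Mat d →ₗ[ℂ] ℂ := traceFunctional LinearMap.id (1 - R') - traceFunctional Ψ (1 - R)
    with hg
  have hg_apply : ∀ A, g A = (A * (1 - R')).trace - (Ψ A * (1 - R)).trace := fun A => rfl
  have hpos : ∀ A, 0 ≤ A → 0 ≤ g A := fun A hA => by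
    rw [hg_apply, sub_nonneg]
    exact h.trace_compl_le hR hR' hinv hA
  have h1 : g E = 0 := by
    refine eq_zero_of_re_eq_zero (hpos E hE) ?_
    rw [hg_apply, Complex.sub_re, hEeq, sub_self]
  have h2 := functional_rangeProj_eq_zero hpos hE h1
  have h3 : g X = 0 := by
    refine le_antisymm ?_ (hpos X hX)
    have := hpos _ (sub_nonneg.2 hXE)
    rwa [map_sub, h2, zero_sub, neg_nonneg] at this
  rw [hg_apply, sub_eq_zero] at h3
  exact h3.symm

/-- Since `S' - R'` lies outside `R'` and below the range projection of `E`, none of its weight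
leaks into `R`; by monotonicity its image also stays under `S`. -/
theorem IsPosTracePreserving.sub_invariant {Ψ : Mat d →ₗ[ℂ] Mat d} (h : IsPosTracePreserving Ψ)
    {R R' S S' E : Mat d} (hR : IsStarProjection R) (hR' : IsStarProjection R')
    (hS : IsStarProjection S) (hS' : IsStarProjection S') (hRS' : R' ≤ S')
    (hinvR : (Ψ R' * (1 - R)).trace.re = 0) (hinvS : (Ψ S' * (1 - S)).trace.re = 0) (hE : 0 ≤ E)
    (hEeq : (Ψ E * (1 - R)).trace.re = (E * (1 - R')).trace.re) (hSE : S' ≤ rangeProj E) :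
    (Ψ (S' - R') * (1 - (S - R))).trace.re = 0 := by
  have hX : 0 ≤ S' - R' := sub_nonneg.2 hRS'
  have hle : S' - R' ≤ S' := sub_le_self _ hR'.nonneg
  have h1 := h.trace_compl_eq hR hR' hinvR hE hEeq hX (hle.trans hSE)
  have h2 : (S' - R') * R' = 0 := by
    rw [sub_mul, hR'.isIdempotentElem.eq, (hR'.le_iff_mul_eq_right hS').1 hRS', sub_self]
  rw [mul_sub (S' - R'), mul_one, h2, sub_zero, ← h.trace_eq (S' - R'), mul_sub, mul_one,
    Matrix.trace_sub, sub_eq_self] at h1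
  have h3 : (Ψ (S' - R') * (1 - S)).trace.re = 0 :=
    le_antisymm (hinvS ▸ trace_mul_re_mono_left (h.mono hle) hS.one_sub.nonneg)
      (trace_mul_re_nonneg (h.nonneg _ hX) hS.one_sub.nonneg)
  have h4 : (1 - (S - R) : Mat d) = (1 - S) + R := by abel
  rw [h4, mul_add, Matrix.trace_add, h1, add_zero, h3]

end Matrices

/-! ### The evolution operator and the stationary limit `𝔈(I)` -/

namespace ERIS

variable {Ω : Type*} [MeasurableSpace Ω] {μ : Measure Ω} {d : ℕ}

theorem isPosTracePreserving (Q : ERIS Ω μ d) (ω : Ω) :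
    IsPosTracePreserving (Q.φ ω).toLinearMap :=
  ⟨fun _ hA => map_nonneg (Q.φ ω).toCompletelyPositiveMap hA, (Q.φ ω).trace_preserving⟩

/-- The transfer operator `(L F)(ω) = φ_ω (F (θ⁻¹ ω))` on random matrices. -/
noncomputable def evolve (Q : ERIS Ω μ d) : (Ω → Mat d) → Ω → Mat d :=
  transfer (fun ω => (Q.φ ω).toLinearMap) Q.θ.symm

theorem evolve_apply (Q : ERIS Ω μ d) (F : Ω → Mat d) (ω : Ω) :
    Q.evolve F ω = (Q.φ ω).toLinearMap (F (Q.θ.symm ω)) := rfl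

theorem measurePreserving (Q : ERIS Ω μ d) : MeasurePreserving Q.θ μ μ :=
  Q.ergodic.toMeasurePreserving

theorem measurePreserving_symm (Q : ERIS Ω μ d) : MeasurePreserving Q.θ.symm μ μ :=
  Q.ergodic.symm.toMeasurePreserving

theorem shift_natCast (Q : ERIS Ω μ d) (n : ℕ) : Q.shift n = Q.θ^[n] := by
  rw [shift, zpow_natCast, Equiv.Perm.coe_pow]
  rfl

theorem shift_neg_natCast (Q : ERIS Ω μ d) (n : ℕ) : Q.shift (-(n : ℤ)) = Q.θ.symm^[n] := by
  rw [shift, zpow_neg, ← inv_zpow, zpow_natCast, Equiv.Perm.coe_pow]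
  rfl

/-- The product `backward N` has `N + 1` factors, from `φ_0` down to `φ_{-N}`, hence the exponent.
-/
theorem backward_apply (Q : ERIS Ω μ d) (N : ℕ) (F : Ω → Mat d) (ω : Ω) :
    Q.backward N ω (F (Q.θ.symm^[N + 1] ω)) = Q.evolve^[N + 1] F ω := by
  induction N generalizing F with
  | zero => rfl
  | succ N ih =>
    rw [Function.iterate_succ_apply Q.evolve, ← ih, backward, LinearMap.comp_apply, channel]
    have h : (-((N : ℤ) + 1)) = -((N + 1 : ℕ) : ℤ) := by push_cast; rfl
    rw [h, shift_neg_natCast, evolve_apply, ← Function.iterate_succ_apply' Q.θ.symm]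

/-- Forward products are iterates of `evolve` seen from `θ^N ω`. As `θ` preserves `μ`, almost sure
bounds and expectations pass between the two pictures. -/
theorem forward_apply (Q : ERIS Ω μ d) (N : ℕ) (F : Ω → Mat d) (ω : Ω) :
    Q.forward N ω (F ω) = Q.evolve^[N] F (Q.θ^[N] ω) := by
  induction N with
  | zero => rfl
  | succ N ih =>
    rw [forward, LinearMap.comp_apply, ih, Function.iterate_succ_apply' Q.evolve, evolve_apply,
      channel]
    have h : ((N : ℤ) + 1) = ((N + 1 : ℕ) : ℤ) := by push_cast; rfl
    rw [h, shift_natCast, Function.iterate_succ_apply' Q.θ, MeasurableEquiv.symm_apply_apply]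

theorem Phi_natCast_apply (Q : ERIS Ω μ d) {N : ℕ} (hN : 1 ≤ N) (F : Ω → Mat d) (ω : Ω) :
    Q.Phi N ω (F ω) = Q.evolve^[N] F (Q.θ^[N] ω) := by
  rw [Phi, if_pos (by exact_mod_cast hN), Int.toNat_natCast, forward_apply]

theorem Phi_neg_one (Q : ERIS Ω μ d) (N : ℕ) (ω : Ω) :
    Q.Phi (-(N : ℤ)) ω 1 = Q.evolve^[N + 1] 1 ω := by
  rw [Phi, if_neg (by simp), neg_neg, Int.toNat_natCast, ← backward_apply]
  rfl

theorem cesaroAvgOne_eq (Q : ERIS Ω μ d) (M : ℕ) (ω : Ω) :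
    Q.cesaroAvgOne M ω = (M : ℝ)⁻¹ • ∑ N ∈ Finset.range M, Q.evolve^[N + 1] 1 ω := by
  simp only [cesaroAvgOne, Phi_neg_one]

/-- One map `Ψ` serves all `F` at once, so every estimate for positive trace-preserving maps holds
for the iterates uniformly in `n`. -/
theorem exists_evolve_iterate_eq (Q : ERIS Ω μ d) (n : ℕ) (ω : Ω) :
    ∃ Ψ : Mat d →ₗ[ℂ] Mat d, IsPosTracePreserving Ψ ∧
      ∀ F : Ω → Mat d, Q.evolve^[n] F ω = Ψ (F (Q.θ.symm^[n] ω)) := by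
  induction n with
  | zero => exact ⟨LinearMap.id, .id, fun F => rfl⟩
  | succ n ih =>
    obtain ⟨Ψ, hΨ, h⟩ := ih
    refine ⟨Ψ ∘ₗ (Q.φ (Q.θ.symm^[n] ω)).toLinearMap, hΨ.comp (Q.isPosTracePreserving _),
      fun F => ?_⟩
    rw [Function.iterate_succ_apply, h, evolve_apply, LinearMap.comp_apply,
      Function.iterate_succ_apply' Q.θ.symm]

theorem evolve_iterate_nonneg (Q : ERIS Ω μ d) (n : ℕ) {F : Ω → Mat d} {ω : Ω}
    (h : 0 ≤ F (Q.θ.symm^[n] ω)) : 0 ≤ Q.evolve^[n] F ω := by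
  obtain ⟨Ψ, hΨ, hF⟩ := Q.exists_evolve_iterate_eq n ω
  rw [hF]
  exact hΨ.nonneg _ h

theorem evolve_iterate_mono (Q : ERIS Ω μ d) (n : ℕ) {F G : Ω → Mat d} {ω : Ω}
    (h : F (Q.θ.symm^[n] ω) ≤ G (Q.θ.symm^[n] ω)) : Q.evolve^[n] F ω ≤ Q.evolve^[n] G ω := by
  obtain ⟨Ψ, hΨ, hF⟩ := Q.exists_evolve_iterate_eq n ω
  rw [hF, hF]
  exact hΨ.mono h

theorem trace_evolve_iterate (Q : ERIS Ω μ d) (n : ℕ) (F : Ω → Mat d) (ω : Ω) :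
    (Q.evolve^[n] F ω).trace = (F (Q.θ.symm^[n] ω)).trace := by
  obtain ⟨Ψ, hΨ, hF⟩ := Q.exists_evolve_iterate_eq n ω
  rw [hF, hΨ.trace_eq]

theorem norm_evolve_iterate_le (Q : ERIS Ω μ d) (n : ℕ) (F : Ω → Mat d) (ω : Ω) :
    ‖Q.evolve^[n] F ω‖ ≤ 6 * d * ‖F (Q.θ.symm^[n] ω)‖ := by
  obtain ⟨Ψ, hΨ, hF⟩ := Q.exists_evolve_iterate_eq n ω
  rw [hF]
  exact hΨ.norm_apply_le _

theorem evolve_iterate_one_nonneg (Q : ERIS Ω μ d) (n : ℕ) (ω : Ω) :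
    0 ≤ Q.evolve^[n] 1 ω :=
  Q.evolve_iterate_nonneg n zero_le_one

theorem trace_evolve_iterate_one (Q : ERIS Ω μ d) (n : ℕ) (ω : Ω) :
    (Q.evolve^[n] 1 ω).trace = d := by
  rw [trace_evolve_iterate]
  simp

theorem norm_evolve_iterate_one_le (Q : ERIS Ω μ d) (n : ℕ) (ω : Ω) :
    ‖Q.evolve^[n] 1 ω‖ ≤ d := by
  have := norm_le_trace_re (Q.evolve_iterate_one_nonneg n ω)
  rwa [trace_evolve_iterate_one, Complex.natCast_re] at this

theorem continuous_entry (i j : Fin d) : Continuous fun A : Mat d => A i j :=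
  (continuous_apply j).comp (continuous_apply i)

theorem aestronglyMeasurable_evolve (Q : ERIS Ω μ d) {F : Ω → Mat d}
    (hF : AEStronglyMeasurable F μ) : AEStronglyMeasurable (Q.evolve F) μ := by
  -- Measurability of `φ` is known only on fixed matrices, so `F` is expanded in matrix units.
  have h : Q.evolve F = fun ω => ∑ i, ∑ j, F (Q.θ.symm ω) i j •
      (Q.φ ω).toLinearMap (Matrix.single i j 1) := by
    ext1 ω
    rw [evolve_apply]
    conv_lhs => rw [Matrix.matrix_eq_sum_single (F (Q.θ.symm ω))]
    simp only [map_sum]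
    refine Finset.sum_congr rfl fun i _ => Finset.sum_congr rfl fun j _ => ?_
    rw [← map_smul]
    simp
  rw [h]
  refine Finset.aestronglyMeasurable_fun_sum _ fun i _ =>
    Finset.aestronglyMeasurable_fun_sum _ fun j _ => ?_
  exact ((continuous_entry i j).comp_aestronglyMeasurable
    (hF.comp_measurePreserving Q.measurePreserving_symm)).smul (Q.measurable_φ _)

theorem aestronglyMeasurable_evolve_iterate (Q : ERIS Ω μ d) (n : ℕ) {F : Ω → Mat d}
    (hF : AEStronglyMeasurable F μ) : AEStronglyMeasurable (Q.evolve^[n] F) μ := by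
  induction n generalizing F with
  | zero => exact hF
  | succ n ih => exact ih (Q.aestronglyMeasurable_evolve hF)

/-- The Cesàro averages of the evolution of a square-integrable random matrix converge almost
surely. -/
theorem exists_ae_tendsto_evolve_average [IsProbabilityMeasure μ] (Q : ERIS Ω μ d) {F : Ω → Mat d}
    (hF : MemLp F 2 μ) :
    ∃ y : Ω → Mat d, ∀ᵐ ω ∂μ, Tendsto
      (fun M : ℕ => (M : ℝ)⁻¹ • ∑ N ∈ Finset.range M, Q.evolve^[N] F ω) atTop (𝓝 (y ω)) := by
  -- The operator norm is not Hilbertian, so the cocycle is conjugated to a Euclidean space; the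
  -- norms of the isomorphism and its inverse enter the constant.
  let E := EuclideanSpace ℂ (Fin (Module.finrank ℂ (Mat d)))
  let e : Mat d ≃L[ℂ] E := ContinuousLinearEquiv.ofFinrankEq finrank_euclideanSpace_fin.symm
  let T : Ω → E →ₗ[ℂ] E := fun ω =>
    e.toLinearMap ∘ₗ (Q.φ ω).toLinearMap ∘ₗ e.symm.toLinearMap
  have hT1 : ∀ G : Ω → E, transfer T Q.θ.symm G = fun ω => e (Q.evolve (fun ω => e.symm (G ω)) ω) :=
    fun G => rfl
  have hTn : ∀ (n : ℕ) (G : Ω → E), (transfer T Q.θ.symm)^[n] G =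
      fun ω => e (Q.evolve^[n] (fun ω => e.symm (G ω)) ω) := by
    intro n
    induction n with
    | zero => intro G; ext1 ω; simp
    | succ n ih =>
      intro G
      rw [Function.iterate_succ_apply, ih, hT1]
      simp only [ContinuousLinearEquiv.symm_apply_apply, Function.iterate_succ_apply]
  obtain ⟨y, hy⟩ := exists_ae_tendsto_transfer_average Q.measurePreserving_symm (T := T)
    (fun G hG => by
      rw [hT1]
      exact e.continuous.comp_aestronglyMeasurable
        (Q.aestronglyMeasurable_evolve (e.symm.continuous.comp_aestronglyMeasurable hG)))
    (K := ‖(e : Mat d →L[ℂ] E)‖ * (6 * d * ‖(e.symm : E →L[ℂ] Mat d)‖))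
    (fun n G ω => by
      rw [hTn]
      refine ((e : Mat d →L[ℂ] E).le_opNorm _).trans ?_
      rw [mul_assoc]
      gcongr
      refine (Q.norm_evolve_iterate_le n _ ω).trans ?_
      rw [mul_assoc (6 * (d : ℝ))]
      gcongr
      exact (e.symm : E →L[ℂ] Mat d).le_opNorm _)
    (F := fun ω => e (F ω)) ((e : Mat d →L[ℂ] E).comp_memLp' hF)
  refine ⟨fun ω => e.symm (y ω), ?_⟩
  filter_upwards [hy] with ω hω
  refine ((e.symm.continuous.tendsto _).comp hω).congr fun M => ?_
  simp only [Function.comp_apply, hTn, ContinuousLinearEquiv.symm_apply_apply]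
  rw [← map_sum, ← Complex.coe_smul, ← map_smul, ContinuousLinearEquiv.symm_apply_apply,
    Complex.coe_smul]

theorem ae_tendsto_cesaroAvgOne [IsProbabilityMeasure μ] (Q : ERIS Ω μ d) :
    ∀ᵐ ω ∂μ, Tendsto (fun M : ℕ => Q.cesaroAvgOne M ω) atTop (𝓝 (Q.cesaroLimitOne ω)) := by
  have h1 : AEStronglyMeasurable (1 : Ω → Mat d) μ := aestronglyMeasurable_const
  -- The averages start at `evolve 1`, not at `1`, because `Φ_0 = φ_0`.
  have hmem : MemLp (Q.evolve 1) 2 μ :=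
    MemLp.of_bound (Q.aestronglyMeasurable_evolve h1) d
      (ae_of_all _ fun ω => Q.norm_evolve_iterate_one_le 1 ω)
  obtain ⟨y, hy⟩ := Q.exists_ae_tendsto_evolve_average hmem
  filter_upwards [hy] with ω hω
  refine tendsto_nhds_limUnder ⟨y ω, hω.congr fun M => ?_⟩
  rw [cesaroAvgOne_eq]
  rfl

theorem cesaroAvgOne_nonneg (Q : ERIS Ω μ d) (M : ℕ) (ω : Ω) : 0 ≤ Q.cesaroAvgOne M ω := by
  rw [cesaroAvgOne_eq]
  exact smul_nonneg (by positivity) (Finset.sum_nonneg fun N _ => Q.evolve_iterate_one_nonneg _ ω)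

theorem trace_re_cesaroAvgOne_le (Q : ERIS Ω μ d) (M : ℕ) (ω : Ω) :
    (Q.cesaroAvgOne M ω).trace.re ≤ d := by
  rw [cesaroAvgOne_eq, Matrix.trace_smul, Matrix.trace_sum]
  simp only [trace_evolve_iterate_one, Finset.sum_const, Finset.card_range, Complex.smul_re,
    nsmul_eq_mul, Complex.mul_re, Complex.natCast_re, Complex.natCast_im, mul_zero, sub_zero,
    smul_eq_mul]
  rcases Nat.eq_zero_or_pos M with rfl | hM
  · simp
  · have : (0 : ℝ) < M := by exact_mod_cast hM
    rw [inv_mul_cancel_left₀ this.ne']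

theorem aestronglyMeasurable_cesaroAvgOne (Q : ERIS Ω μ d) (M : ℕ) :
    AEStronglyMeasurable (Q.cesaroAvgOne M) μ := by
  have h1 : AEStronglyMeasurable (1 : Ω → Mat d) μ := aestronglyMeasurable_const
  have : Q.cesaroAvgOne M = fun ω => (M : ℝ)⁻¹ • ∑ N ∈ Finset.range M, Q.evolve^[N + 1] 1 ω :=
    funext (Q.cesaroAvgOne_eq M)
  rw [this]
  exact AEStronglyMeasurable.const_smul (Finset.aestronglyMeasurable_fun_sum _ fun N _ =>
    Q.aestronglyMeasurable_evolve_iterate _ h1) (M : ℝ)⁻¹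

theorem continuous_trace_re : Continuous fun A : Mat d => A.trace.re :=
  Complex.continuous_re.comp (continuous_id.matrix_trace)

section Limit

variable [IsProbabilityMeasure μ] (Q : ERIS Ω μ d)

theorem aestronglyMeasurable_cesaroLimitOne : AEStronglyMeasurable Q.cesaroLimitOne μ :=
  aestronglyMeasurable_of_tendsto_ae atTop Q.aestronglyMeasurable_cesaroAvgOne
    Q.ae_tendsto_cesaroAvgOne

theorem cesaroLimitOne_nonneg : ∀ᵐ ω ∂μ, 0 ≤ Q.cesaroLimitOne ω := by
  filter_upwards [Q.ae_tendsto_cesaroAvgOne] with ω hω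
  exact ge_of_tendsto' hω fun M => Q.cesaroAvgOne_nonneg M ω

theorem trace_re_cesaroLimitOne_le : ∀ᵐ ω ∂μ, (Q.cesaroLimitOne ω).trace.re ≤ d := by
  filter_upwards [Q.ae_tendsto_cesaroAvgOne] with ω hω
  exact le_of_tendsto' ((continuous_trace_re.tendsto _).comp hω)
    fun M => Q.trace_re_cesaroAvgOne_le M ω

/-- `𝔈(I)` is stationary. -/
theorem evolve_cesaroLimitOne : ∀ᵐ ω ∂μ, Q.evolve Q.cesaroLimitOne ω = Q.cesaroLimitOne ω := by
  filter_upwards [Q.ae_tendsto_cesaroAvgOne,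
    Q.measurePreserving_symm.quasiMeasurePreserving.ae Q.ae_tendsto_cesaroAvgOne] with ω h1 h2
  have hcont : Continuous (Q.φ ω).toLinearMap := LinearMap.continuous_of_finiteDimensional _
  have h3 := (hcont.tendsto _).comp h2
  have hbound : Tendsto (fun M : ℕ => (M : ℝ)⁻¹ •
      (Q.evolve^[M + 1] 1 ω - Q.evolve^[1] 1 ω)) atTop (𝓝 0) := by
    have hb : ∀ M : ℕ, ‖(M : ℝ)⁻¹ • (Q.evolve^[M + 1] 1 ω - Q.evolve^[1] 1 ω)‖ ≤
        (M : ℝ)⁻¹ * (d + d) := by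
      intro M
      rw [norm_smul, norm_inv, Real.norm_natCast]
      gcongr
      exact (norm_sub_le _ _).trans
        (add_le_add (Q.norm_evolve_iterate_one_le _ ω) (Q.norm_evolve_iterate_one_le _ ω))
    refine squeeze_zero_norm hb ?_
    simpa using (tendsto_inv_atTop_nhds_zero_nat (𝕜 := ℝ)).mul_const ((d : ℝ) + d)
  have h4 := hbound.add h1
  rw [zero_add] at h4
  refine tendsto_nhds_unique (h3.congr fun M => ?_) h4
  have ht := Finset.sum_range_sub (fun N => Q.evolve^[N + 1] 1 ω) M
  simp only [Function.comp_apply, cesaroAvgOne_eq]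
  rw [← ht, ← smul_add, ← Finset.sum_add_distrib, ← Complex.coe_smul, map_smul, map_sum,
    Complex.coe_smul]
  congr 1
  refine Finset.sum_congr rfl fun N _ => ?_
  rw [sub_add_cancel, Function.iterate_succ_apply' Q.evolve (N + 1), evolve_apply]

end Limit

end ERIS

/-! ### Reducing projections and ergodicity -/

section Reducing

variable {Ω : Type*} [MeasurableSpace Ω] {μ : Measure Ω} {d : ℕ}

/-- The channels map the corner of `P` at `θ⁻¹ ω` into the corner of `P` at `ω`. -/
def IsInvariant (Q : ERIS Ω μ d) (P : Ω → Mat d) : Prop :=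
  ∀ᵐ ω ∂μ, (Q.evolve P ω * (1 - P ω)).trace.re = 0

/-- Invariance keeps the iterates supported under `P` and their trace is at most `d`. The extra `1`
covers `N = 0` and keeps the constant positive when `d = 0`. -/
theorem IsInvariant.evolve_iterate_le {Q : ERIS Ω μ d} {P : Ω → Mat d}
    (hP : ∀ᵐ ω ∂μ, IsStarProjection (P ω)) (hinv : IsInvariant Q P) (N : ℕ) :
    ∀ᵐ ω ∂μ, Q.evolve^[N] P ω ≤ ((d : ℝ) + 1) • P ω := by
  induction N with
  | zero =>
    filter_upwards [hP] with ω hω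
    rw [add_smul, one_smul]
    exact le_add_of_nonneg_left (smul_nonneg (Nat.cast_nonneg d) hω.nonneg)
  | succ N ih =>
    filter_upwards [hP, hinv, Q.measurePreserving_symm.quasiMeasurePreserving.ae ih,
      (Q.measurePreserving_symm.iterate (N + 1)).quasiMeasurePreserving.ae hP] with ω h1 h2 h3 h4
    have hpos : 0 ≤ Q.evolve^[N + 1] P ω := Q.evolve_iterate_nonneg _ h4.nonneg
    have hle : Q.evolve^[N + 1] P ω ≤ ((d : ℝ) + 1) • Q.evolve P ω := by
      rw [Function.iterate_succ_apply', ERIS.evolve_apply, ERIS.evolve_apply]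
      refine ((Q.isPosTracePreserving ω).mono h3).trans (le_of_eq ?_)
      rw [← Complex.coe_smul, map_smul, Complex.coe_smul]
    have hzero : (Q.evolve^[N + 1] P ω * (1 - P ω)).trace.re = 0 := by
      refine le_antisymm ?_ (trace_mul_re_nonneg hpos h1.one_sub.nonneg)
      refine (trace_mul_re_mono_left hle h1.one_sub.nonneg).trans (le_of_eq ?_)
      rw [smul_mul_assoc, Matrix.trace_smul, Complex.smul_re, h2, smul_zero]
    refine (le_trace_smul_proj hpos h1 hzero).trans ?_
    refine smul_le_smul_of_nonneg_right ?_ h1.nonneg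
    rw [Q.trace_evolve_iterate]
    exact (proj_trace_re_le h4).trans (by linarith)

/-- Only `N = 1` is needed to get invariance; conversely the nonrandom constant `d + 1` works for
all `N`. -/
theorem reduces_iff {Q : ERIS Ω μ d} {P : Ω → Mat d} :
    Reduces Q P ↔ IsRandomProjection μ P ∧ IsInvariant Q P := by
  constructor
  · rintro ⟨hP, C, -, -, h⟩
    refine ⟨hP, ?_⟩
    filter_upwards [hP.2, Q.measurePreserving_symm.quasiMeasurePreserving.ae (h 1 le_rfl),
      Q.measurePreserving_symm.quasiMeasurePreserving.ae hP.2] with ω h1 h2 h3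
    rw [Q.Phi_natCast_apply le_rfl, Q.shift_natCast, Function.iterate_one, Function.iterate_one,
      MeasurableEquiv.apply_symm_apply] at h2
    have hpos : 0 ≤ Q.evolve P ω := Q.evolve_iterate_nonneg 1 h3.nonneg
    refine le_antisymm ?_ (trace_mul_re_nonneg hpos h1.one_sub.nonneg)
    refine (trace_mul_re_mono_left h2 h1.one_sub.nonneg).trans (le_of_eq ?_)
    rw [smul_mul_assoc, h1.mul_one_sub_self]
    simp
  · rintro ⟨hP, hinv⟩
    refine ⟨hP, fun _ => (d : ℝ) + 1, aemeasurable_const, ae_of_all _ fun _ => by positivity,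
      fun N hN => ?_⟩
    filter_upwards [(Q.measurePreserving.iterate N).quasiMeasurePreserving.ae
      (hinv.evolve_iterate_le hP.2 N)] with ω hω
    rwa [Q.Phi_natCast_apply hN, Q.shift_natCast]

/-- By ergodicity, a reducing projection vanishes almost surely or almost never. -/
theorem Reduces.ae_ne_zero [IsFiniteMeasure μ] {Q : ERIS Ω μ d} {P : Ω → Mat d} (h : Reduces Q P)
    (hne : ¬ ∀ᵐ ω ∂μ, P ω = 0) : ∀ᵐ ω ∂μ, P ω ≠ 0 := by
  obtain ⟨hP, hinv⟩ := reduces_iff.1 h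
  have hnull : NullMeasurableSet {ω | P ω = 0} μ :=
    hP.1.nullMeasurableSet_eq_fun aestronglyMeasurable_const
  -- If `P ω = 0`, invariance forces `Tr (evolve P ω) = 0`, and this trace is that of `P (θ⁻¹ ω)`.
  have hle : {ω | P ω = 0} ≤ᵐ[μ] Q.θ.symm ⁻¹' {ω | P ω = 0} := by
    filter_upwards [hinv, Q.measurePreserving_symm.quasiMeasurePreserving.ae hP.2]
      with ω h1 h2 h3
    have h3' : P ω = 0 := h3
    change P (Q.θ.symm ω) = 0
    have h4 : (Q.evolve P ω).trace = (P (Q.θ.symm ω)).trace := Q.trace_evolve_iterate 1 P ω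
    rw [h3', sub_zero, mul_one, h4] at h1
    have h5 := norm_le_trace_re h2.nonneg
    rw [h1] at h5
    exact norm_le_zero_iff.1 h5
  rcases Q.ergodic.symm.ae_empty_or_univ_of_ae_le_preimage hnull hle with h0 | h0
  · filter_upwards [h0] with ω hω hPω
    exact (hω.mp hPω : ω ∈ (∅ : Set Ω)).elim
  · refine absurd ?_ hne
    filter_upwards [h0] with ω hω
    exact (hω.mpr trivial : ω ∈ {ω | P ω = 0})

theorem trace_cesaroLimitOne_mul_transientProj (Q : ERIS Ω μ d) (ω : Ω) :
    (Q.cesaroLimitOne ω * (1 - Q.recurrentProj ω)).trace = 0 := by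
  rw [Matrix.trace_mul_comm, sub_mul, one_mul, ERIS.recurrentProj, rangeProj_mul_self, sub_self,
    Matrix.trace_zero]

variable [IsProbabilityMeasure μ]

/-- `rangeProj` is not continuous, but it is a pointwise limit of polynomials in `𝔈(I)`, which is
bounded by `d + 1`. -/
theorem aestronglyMeasurable_recurrentProj (Q : ERIS Ω μ d) :
    AEStronglyMeasurable Q.recurrentProj μ := by
  refine aestronglyMeasurable_of_tendsto_ae atTop
    (f := fun (n : ℕ) ω => 1 - (n : ℂ)⁻¹ • ∑ k ∈ Finset.range n,
      (1 - ((d : ℝ) + 1)⁻¹ • Q.cesaroLimitOne ω) ^ k) (fun n => ?_) ?_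
  · have hcont : Continuous fun A : Mat d => 1 - (n : ℂ)⁻¹ • ∑ k ∈ Finset.range n,
        (1 - ((d : ℝ) + 1)⁻¹ • A) ^ k := by fun_prop
    exact hcont.comp_aestronglyMeasurable Q.aestronglyMeasurable_cesaroLimitOne
  · filter_upwards [Q.cesaroLimitOne_nonneg, Q.trace_re_cesaroLimitOne_le] with ω h1 h2
    refine tendsto_rangeProj h1 (by positivity) ((le_trace_re_smul_one h1).trans ?_)
    exact smul_le_smul_of_nonneg_right (by linarith) zero_le_one

/-- By stationarity, the weight that `φ_ω` sends outside `P_r` is a positive functional vanishing at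
`𝔈(I)(θ⁻¹ω)`, hence at its range projection. -/
theorem reduces_recurrentProj (Q : ERIS Ω μ d) : Reduces Q Q.recurrentProj := by
  refine reduces_iff.2 ⟨⟨aestronglyMeasurable_recurrentProj Q,
    ae_of_all _ fun ω => rangeProj_isStarProjection _⟩, ?_⟩
  filter_upwards [Q.evolve_cesaroLimitOne,
    Q.measurePreserving_symm.quasiMeasurePreserving.ae Q.cesaroLimitOne_nonneg] with ω h1 h2
  have h3 := functional_rangeProj_eq_zero ((Q.isPosTracePreserving ω).traceFunctional_nonneg
    (rangeProj_isStarProjection (Q.cesaroLimitOne ω)).one_sub.nonneg) h2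
    (by
      rw [traceFunctional_apply, ← ERIS.evolve_apply, h1]
      exact trace_cesaroLimitOne_mul_transientProj Q ω)
  rw [traceFunctional_apply] at h3
  change ((Q.φ ω).toLinearMap _ * _).trace.re = 0
  rw [ERIS.recurrentProj, ERIS.recurrentProj, h3, Complex.zero_re]

/-- Below the recurrent projection, differences of reducing projections are reducing. -/
theorem Reduces.sub {Q : ERIS Ω μ d} {R S : Ω → Mat d} (hR : Reduces Q R) (hS : Reduces Q S)
    (hRS : ∀ᵐ ω ∂μ, R ω ≤ S ω) (hSr : ∀ᵐ ω ∂μ, S ω ≤ Q.recurrentProj ω) :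
    Reduces Q (S - R) := by
  obtain ⟨hPR, hinvR⟩ := reduces_iff.1 hR
  obtain ⟨hPS, hinvS⟩ := reduces_iff.1 hS
  have hq := Q.measurePreserving_symm.quasiMeasurePreserving
  set h : Ω → ℝ := fun ω => (Q.cesaroLimitOne ω * (1 - R ω)).trace.re with hh
  have hmeas : AEStronglyMeasurable h μ :=
    ERIS.continuous_trace_re.comp_aestronglyMeasurable
      (Q.aestronglyMeasurable_cesaroLimitOne.mul (aestronglyMeasurable_const.sub hPR.1))
  have h_int : Integrable h μ := by
    refine Integrable.of_bound hmeas (d : ℝ) ?_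
    filter_upwards [Q.cesaroLimitOne_nonneg, Q.trace_re_cesaroLimitOne_le, hPR.2] with ω h1 h2 h3
    rw [Real.norm_of_nonneg (trace_mul_re_nonneg h1 h3.one_sub.nonneg)]
    refine le_trans ?_ h2
    have := trace_mul_re_mono_right h1 (sub_le_self 1 h3.nonneg)
    rwa [mul_one] at this
  have hle : h ≤ᵐ[μ] h ∘ Q.θ.symm := by
    filter_upwards [Q.evolve_cesaroLimitOne, hq.ae Q.cesaroLimitOne_nonneg, hPR.2, hq.ae hPR.2,
      hinvR] with ω h1 h2 h3 h4 h5
    have h6 := (Q.isPosTracePreserving ω).trace_compl_le h3 h4 h5 h2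
    rw [← ERIS.evolve_apply, h1] at h6
    exact (Complex.le_def.1 h6).1
  have h_intτ : Integrable (h ∘ Q.θ.symm) μ :=
    Q.measurePreserving_symm.integrable_comp_of_integrable h_int
  -- An almost sure inequality between functions of equal integral is an equality. This is the
  -- no-leak hypothesis of `sub_invariant`.
  have heq : h =ᵐ[μ] h ∘ Q.θ.symm := by
    refine (integral_eq_iff_of_ae_le h_int h_intτ hle).1 ?_
    exact (Q.measurePreserving_symm.integral_comp Q.θ.symm.measurableEmbedding h).symm
  have hproj : ∀ᵐ ω ∂μ, IsStarProjection ((S - R) ω) := by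
    filter_upwards [hPR.2, hPS.2, hRS] with ω h1 h2 h3
    exact (h1.le_iff_sub h2).1 h3
  refine reduces_iff.2 ⟨⟨hPS.1.sub hPR.1, hproj⟩, ?_⟩
  filter_upwards [Q.evolve_cesaroLimitOne, hq.ae Q.cesaroLimitOne_nonneg, hPR.2, hq.ae hPR.2,
      hPS.2, hq.ae hPS.2, hq.ae hRS, hinvR, hinvS, hq.ae hSr, heq]
      with ω h1 h2 h3 h4 h5 h6 h7 h8 h9 h10 h11
  refine (Q.isPosTracePreserving ω).sub_invariant h3 h4 h5 h6 h7 h8 h9 h2 ?_ h10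
  rw [← ERIS.evolve_apply, h1]
  exact h11

/-! ### Splitting the recurrent projection into minimal pieces -/

/-- The recurrent projection is a sum of `m` nonzero reducing projections. -/
def HasReducingDecomposition (Q : ERIS Ω μ d) (m : ℕ) : Prop :=
  ∃ P : Fin m → Ω → Mat d, (∀ i, Reduces Q (P i) ∧ ¬ ∀ᵐ ω ∂μ, P i ω = 0) ∧
    ∀ᵐ ω ∂μ, ∑ i, P i ω = Q.recurrentProj ω

/-- Ergodicity gives a single `ω` at which all the projections are nonzero; each then has trace at
least `1`, and the sum has trace at most `d`. -/
theorem HasReducingDecomposition.le {Q : ERIS Ω μ d} {m : ℕ} (h : HasReducingDecomposition Q m) :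
    m ≤ d := by
  obtain ⟨P, hP, hsum⟩ := h
  have hproj : ∀ᵐ ω ∂μ, ∀ i, IsStarProjection (P i ω) := ae_all_iff.2 fun i => (hP i).1.1.2
  have hne : ∀ᵐ ω ∂μ, ∀ i, P i ω ≠ 0 := ae_all_iff.2 fun i => (hP i).1.ae_ne_zero (hP i).2
  obtain ⟨ω, h1, h2, h3⟩ := (hsum.and (hproj.and hne)).exists
  have h4 : ∀ i, 1 ≤ (P i ω).trace.re := by
    intro i
    refine le_trans (le_of_eq ?_) (norm_le_trace_re (h2 i).nonneg)
    have h5 : ‖P i ω‖ * ‖P i ω‖ = ‖P i ω‖ := by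
      rw [← CStarRing.norm_star_mul_self, (h2 i).isSelfAdjoint.star_eq, (h2 i).isIdempotentElem.eq]
    exact (mul_right_cancel₀ (norm_ne_zero_iff.2 (h3 i)) (h5.trans (one_mul _).symm)).symm
  have h5 : (m : ℝ) ≤ d := by
    calc (m : ℝ) = ∑ _i : Fin m, (1 : ℝ) := by simp
      _ ≤ ∑ i, (P i ω).trace.re := Finset.sum_le_sum fun i _ => h4 i
      _ = (Q.recurrentProj ω).trace.re := by rw [← h1, Matrix.trace_sum, Complex.re_sum]
      _ ≤ d := proj_trace_re_le (rangeProj_isStarProjection _)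
  exact_mod_cast h5

theorem exists_maximal_reducingDecomposition (Q : ERIS Ω μ d) :
    ∃ m, HasReducingDecomposition Q m ∧ ¬ HasReducingDecomposition Q (m + 1) := by
  have h0 : ∃ m, HasReducingDecomposition Q m := by
    by_cases h : ∀ᵐ ω ∂μ, Q.recurrentProj ω = 0
    · refine ⟨0, Fin.elim0, fun i => i.elim0, ?_⟩
      filter_upwards [h] with ω hω
      simp [hω]
    · exact ⟨1, fun _ => Q.recurrentProj, fun _ => ⟨reduces_recurrentProj Q, h⟩, by simp⟩
  by_contra! hstep
  obtain ⟨m, hm⟩ := h0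
  have hall : ∀ k, HasReducingDecomposition Q (m + k) := by
    intro k
    induction k with
    | zero => exact hm
    | succ k ih => exact hstep _ ih
  have := (hall (d + 1)).le
  omega

theorem exists_minimalReducing_decomposition (Q : ERIS Ω μ d) :
    ∃ (m : ℕ) (P : Fin m → Ω → Mat d), (∀ i, IsMinimalReducing Q (P i)) ∧
      (∀ i j, i ≠ j → ∀ᵐ ω ∂μ, P i ω * P j ω = 0 ∧ P j ω * P i ω = 0) ∧
      ∀ᵐ ω ∂μ, ∑ i, P i ω = Q.recurrentProj ω := by
  obtain ⟨m, ⟨P, hP, hsum⟩, hmax⟩ := exists_maximal_reducingDecomposition Q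
  have hproj : ∀ᵐ ω ∂μ, ∀ i, IsStarProjection (P i ω) := ae_all_iff.2 fun i => (hP i).1.1.2
  refine ⟨m, P, fun i => ⟨hP i, fun P' hP' hne hle => ?_⟩, fun i j hij => ?_, hsum⟩
  · by_contra hneq
    -- A strictly smaller nonzero reducing `P'` would split `P i` into `P'` and `P i - P'`, both
    -- nonzero and reducing, giving `m + 1` pieces.
    refine hmax ⟨Fin.cons P' (Function.update P i (P i - P')), ?_, ?_⟩
    · have hPi : ∀ᵐ ω ∂μ, P i ω ≤ Q.recurrentProj ω := by
        filter_upwards [hsum, hproj] with ω h1 h2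
        rw [← h1]
        exact Finset.single_le_sum (f := fun i => P i ω) (fun j _ => (h2 j).nonneg)
          (Finset.mem_univ i)
      refine Fin.cases ⟨hP', hne⟩ fun j => ?_
      rw [Fin.cons_succ]
      rcases eq_or_ne j i with rfl | hji
      · rw [Function.update_self]
        refine ⟨hP'.sub (hP j).1 hle hPi, fun h => hneq ?_⟩
        filter_upwards [h] with ω hω
        exact (sub_eq_zero.1 hω).symm
      · rw [Function.update_of_ne hji]
        exact hP j
    · filter_upwards [hsum] with ω hω
      have h1 : ∀ j, Function.update P i (P i - P') j ω =
          P j ω - if j = i then P' ω else 0 := by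
        intro j
        rcases eq_or_ne j i with rfl | hji
        · simp
        · simp [hji]
      rw [Fin.sum_univ_succ]
      simp only [Fin.cons_zero, Fin.cons_succ, h1, Finset.sum_sub_distrib, Finset.sum_ite_eq',
        Finset.mem_univ, if_true, hω]
      abel
  · filter_upwards [hsum, hproj] with ω h1 h2
    -- Orthogonality is automatic: the whole sum is a projection, so `P i ≤ 1 - P j`.
    have h3 : P i ω + P j ω ≤ 1 := by
      rw [← Finset.sum_pair (f := fun i => P i ω) hij]
      refine (Finset.sum_le_sum_of_subset_of_nonneg (Finset.subset_univ _)
        fun k _ _ => (h2 k).nonneg).trans ?_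
      rw [h1]
      exact (rangeProj_isStarProjection _).le_one
    have h4 : P i ω ≤ 1 - P j ω := le_sub_right_of_add_le h3
    have h5 := ((h2 i).le_iff_mul_eq_left (h2 j).one_sub).1 h4
    have h6 := ((h2 i).le_iff_mul_eq_right (h2 j).one_sub).1 h4
    constructor
    · simpa [mul_sub] using h5
    · simpa [sub_mul] using h6

end Reducing

/-! ### Decay of correlations in the transient corner -/

section Transient

variable {Ω : Type*} [MeasurableSpace Ω] {μ : Measure Ω} {d : ℕ}

theorem exists_norm_trace_le (d : ℕ) : ∃ c : ℝ, 0 ≤ c ∧ ∀ A : Mat d, ‖A.trace‖ ≤ c * ‖A‖ :=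
  ⟨_, norm_nonneg _, (LinearMap.toContinuousLinearMap
    (Matrix.traceLinearMap (Fin d) ℂ ℂ : Mat d →ₗ[ℂ] ℂ)).le_opNorm⟩

/-- By cyclicity the compression moves from `Y` to `A`, and the norm of `P A P ≥ 0` is at most its
trace `Tr(A P)`. -/
theorem exists_norm_hsInner_le (d : ℕ) : ∃ c : ℝ, 0 ≤ c ∧ ∀ A P Y : Mat d, 0 ≤ A →
    IsStarProjection P → P * Y * P = Y → ‖hsInner A Y‖ ≤ c * (A * P).trace.re * ‖Y‖ := by
  obtain ⟨c, hc, h⟩ := exists_norm_trace_le d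
  refine ⟨c, hc, fun A P Y hA hP hY => ?_⟩
  have hB : 0 ≤ P * A * P := by
    have := star_right_conjugate_nonneg hA P
    rwa [hP.isSelfAdjoint.star_eq] at this
  have h1 : hsInner A Y = (P * A * P * Y).trace := by
    have hAs : Matrix.conjTranspose A = A := (IsSelfAdjoint.of_nonneg hA).star_eq
    rw [hsInner, hAs]
    conv_lhs => rw [← hY]
    rw [← mul_assoc, Matrix.trace_mul_comm]
    simp only [mul_assoc]
  have h2 : (P * A * P).trace = (A * P).trace := by
    rw [mul_assoc, Matrix.trace_mul_comm, mul_assoc, hP.isIdempotentElem.eq]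
  rw [h1, mul_assoc c]
  refine (h _).trans ?_
  gcongr
  refine (norm_mul_le _ _).trans ?_
  gcongr
  rw [← h2]
  exact norm_le_trace_re hB

theorem exists_norm_hsInner_le_trace (d : ℕ) : ∃ c : ℝ, 0 ≤ c ∧ ∀ A Y : Mat d, 0 ≤ A →
    ‖hsInner A Y‖ ≤ c * A.trace.re * ‖Y‖ := by
  obtain ⟨c, hc, h⟩ := exists_norm_hsInner_le d
  refine ⟨c, hc, fun A Y hA => ?_⟩
  have := h A 1 Y hA (.one _) (by simp)
  rwa [mul_one] at this

/-- The expected weight of `L^N I` in the transient corner. -/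
noncomputable def transientWeight (Q : ERIS Ω μ d) (N : ℕ) : ℝ :=
  ∫ ω, (Q.evolve^[N] 1 ω * Q.transientProj ω).trace.re ∂μ

theorem transientProj_isStarProjection (Q : ERIS Ω μ d) (ω : Ω) :
    IsStarProjection (Q.transientProj ω) :=
  (rangeProj_isStarProjection _).one_sub

theorem trace_re_mul_transientProj_le (Q : ERIS Ω μ d) {A : Mat d} (hA : 0 ≤ A) (ω : Ω) :
    (A * Q.transientProj ω).trace.re ≤ A.trace.re := by
  have := trace_mul_re_mono_right hA (transientProj_isStarProjection Q ω).le_one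
  rwa [mul_one] at this

theorem transientWeight_nonneg (Q : ERIS Ω μ d) (N : ℕ) : 0 ≤ transientWeight Q N :=
  integral_nonneg fun ω => trace_mul_re_nonneg (Q.evolve_iterate_one_nonneg N ω)
    (transientProj_isStarProjection Q ω).nonneg

variable [IsProbabilityMeasure μ]

theorem integrable_trace_mul_transientProj (Q : ERIS Ω μ d) {F : Ω → Mat d}
    (hF : AEStronglyMeasurable F μ) (hF0 : ∀ ω, 0 ≤ F ω) {c : ℝ} (hc : ∀ ω, (F ω).trace.re ≤ c) :
    Integrable (fun ω => (F ω * Q.transientProj ω).trace.re) μ := by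
  refine Integrable.of_bound (ERIS.continuous_trace_re.comp_aestronglyMeasurable
    (hF.mul (aestronglyMeasurable_const.sub (aestronglyMeasurable_recurrentProj Q)))) c
    (ae_of_all _ fun ω => ?_)
  rw [Real.norm_of_nonneg (trace_mul_re_nonneg (hF0 ω) (transientProj_isStarProjection Q ω).nonneg)]
  exact (trace_re_mul_transientProj_le Q (hF0 ω) ω).trans (hc ω)

theorem integrable_transientWeight (Q : ERIS Ω μ d) (N : ℕ) :
    Integrable (fun ω => (Q.evolve^[N] 1 ω * Q.transientProj ω).trace.re) μ :=
  integrable_trace_mul_transientProj Q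
    (Q.aestronglyMeasurable_evolve_iterate N aestronglyMeasurable_const)
    (Q.evolve_iterate_one_nonneg N) (c := d)
    fun ω => by rw [Q.trace_evolve_iterate_one, Complex.natCast_re]

/-- The average equals `E Tr(cesaroAvgOne · P_t)`, dominated by `d`; its limit is zero because `P_t`
kills the range of `𝔈(I)`. -/
theorem tendsto_average_transientWeight (Q : ERIS Ω μ d) :
    Tendsto (fun M : ℕ => (M : ℝ)⁻¹ * ∑ N ∈ Finset.range M, transientWeight Q (N + 1)) atTop
      (𝓝 0) := by
  have h1 : ∀ M : ℕ, (M : ℝ)⁻¹ * ∑ N ∈ Finset.range M, transientWeight Q (N + 1) =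
      ∫ ω, (Q.cesaroAvgOne M ω * Q.transientProj ω).trace.re ∂μ := by
    intro M
    simp only [transientWeight]
    rw [← integral_finsetSum _ fun N _ => integrable_transientWeight Q (N + 1),
      ← integral_const_mul]
    refine integral_congr_ae (ae_of_all _ fun ω => ?_)
    simp only [Q.cesaroAvgOne_eq, smul_mul_assoc, Matrix.trace_smul, Finset.sum_mul,
      Matrix.trace_sum, Complex.smul_re, Complex.re_sum, smul_eq_mul]
  simp only [h1]
  have h2 : ∫ _ω : Ω, (0 : ℝ) ∂μ = 0 := by simp
  rw [← h2]
  refine tendsto_integral_of_dominated_convergence (fun _ => (d : ℝ)) (fun M => ?_)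
    (integrable_const _) (fun M => ae_of_all _ fun ω => ?_) ?_
  · exact (integrable_trace_mul_transientProj Q (Q.aestronglyMeasurable_cesaroAvgOne M)
      (Q.cesaroAvgOne_nonneg M) (Q.trace_re_cesaroAvgOne_le M)).1
  · rw [Real.norm_of_nonneg (trace_mul_re_nonneg (Q.cesaroAvgOne_nonneg M ω)
      (transientProj_isStarProjection Q ω).nonneg)]
    exact (trace_re_mul_transientProj_le Q (Q.cesaroAvgOne_nonneg M ω) ω).trans
      (Q.trace_re_cesaroAvgOne_le M ω)
  · filter_upwards [Q.ae_tendsto_cesaroAvgOne] with ω hω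
    have h3 := (ERIS.continuous_trace_re.tendsto _).comp (hω.mul_const (Q.transientProj ω))
    rwa [ERIS.transientProj, trace_cesaroLimitOne_mul_transientProj, Complex.zero_re] at h3

/-- The mean correlations with an observable in the transient corner vanish in the limit. -/
theorem tendsto_average_correlation_transient (Q : ERIS Ω μ d) {Y : Ω → Mat d}
    (hY : InCorner μ Q.transientProj Y) {ϑ : Ω → Mat d} (hϑ : IsRandomState μ ϑ) :
    Tendsto (fun M : ℕ => (M : ℂ)⁻¹ * ∑ N ∈ Finset.range M,
      ∫ ω, hsInner (Q.Phi N ω (ϑ ω)) (Y (Q.shift N ω)) ∂μ) atTop (𝓝 0) := by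
  obtain ⟨c, hc, hcY⟩ := exists_norm_hsInner_le d
  obtain ⟨c', hc', hcY'⟩ := exists_norm_hsInner_le_trace d
  obtain ⟨K, hK0, hK⟩ : ∃ K : ℝ, 0 ≤ K ∧ ∀ᵐ ω ∂μ, ‖Y ω‖ ≤ K :=
    ⟨(eLpNormEssSup Y μ).toReal, ENNReal.toReal_nonneg, by
      have htop : eLpNormEssSup Y μ ≠ ∞ := by simpa using hY.1.2.ne
      filter_upwards [ae_le_eLpNormEssSup (f := Y) (μ := μ)] with ω hω
      simpa using ENNReal.toReal_mono htop hω⟩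
  set t : ℕ → ℂ := fun N => ∫ ω, hsInner (Q.Phi N ω (ϑ ω)) (Y (Q.shift N ω)) ∂μ with ht
  have hstate_le : ∀ᵐ ω ∂μ, 0 ≤ ϑ ω ∧ ϑ ω ≤ 1 := by
    filter_upwards [hϑ.2] with ω hω
    refine ⟨hω.1, ?_⟩
    have := le_trace_re_smul_one hω.1
    rwa [hω.2, Complex.one_re, one_smul] at this
  have ht_pos : ∀ N : ℕ, 1 ≤ N → ‖t N‖ ≤ c * K * transientWeight Q N := by
    intro N hN
    have hmp := Q.measurePreserving.iterate N
    have h_int := (integrable_transientWeight Q N).const_mul (c * K)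
    have hb : ∀ᵐ ω ∂μ, ‖hsInner (Q.Phi N ω (ϑ ω)) (Y (Q.shift N ω))‖ ≤
        c * K * (Q.evolve^[N] 1 (Q.θ^[N] ω) * Q.transientProj (Q.θ^[N] ω)).trace.re := by
      have hback : ∀ᵐ ω ∂μ, 0 ≤ Q.evolve^[N] ϑ ω ∧ Q.evolve^[N] ϑ ω ≤ Q.evolve^[N] 1 ω := by
        filter_upwards [(Q.measurePreserving_symm.iterate N).quasiMeasurePreserving.ae hstate_le]
          with ω hω
        exact ⟨Q.evolve_iterate_nonneg N hω.1, Q.evolve_iterate_mono N hω.2⟩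
      filter_upwards [hmp.quasiMeasurePreserving.ae hback, hmp.quasiMeasurePreserving.ae hY.2,
        hmp.quasiMeasurePreserving.ae hK] with ω h1 h2 h3
      rw [Q.Phi_natCast_apply hN, Q.shift_natCast]
      have hproj := transientProj_isStarProjection Q (Q.θ^[N] ω)
      refine (hcY _ _ _ h1.1 hproj h2).trans ?_
      have h4 := trace_mul_re_mono_left h1.2 hproj.nonneg
      have h5 := trace_mul_re_nonneg h1.1 hproj.nonneg
      rw [mul_right_comm]
      gcongr
    have h_int' := hmp.integrable_comp_of_integrable h_int
    refine (norm_integral_le_of_norm_le h_int' hb).trans (le_of_eq ?_)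
    rw [transientWeight, ← integral_const_mul]
    have h6 := integral_map hmp.aemeasurable (by rw [hmp.map_eq]; exact h_int.1)
    rw [hmp.map_eq] at h6
    exact h6.symm
  -- The term `N = 0` is exceptional: `Φ_0` is `φ_0`, not the identity. A crude bound suffices, as
  -- it is divided by `M`.
  have ht_zero : ‖t 0‖ ≤ c' * K := by
    have hb : ∀ᵐ ω ∂μ, ‖hsInner (Q.Phi (0 : ℕ) ω (ϑ ω)) (Y (Q.shift (0 : ℕ) ω))‖ ≤ c' * K := by
      filter_upwards [hϑ.2, hK] with ω h1 h2
      have h3 : Q.Phi (0 : ℕ) ω (ϑ ω) = (Q.φ ω).toLinearMap (ϑ ω) := rfl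
      have h4 : Q.shift (0 : ℕ) ω = ω := rfl
      rw [h3, h4]
      refine (hcY' _ _ ((Q.isPosTracePreserving ω).nonneg _ h1.1)).trans ?_
      rw [(Q.isPosTracePreserving ω).trace_eq, h1.2, Complex.one_re, mul_one]
      gcongr
    refine (norm_integral_le_of_norm_le (integrable_const _) hb).trans (le_of_eq ?_)
    simp
  have hsum : ∀ M : ℕ, ‖∑ N ∈ Finset.range M, t N‖ ≤
      c' * K + c * K * ∑ N ∈ Finset.range M, transientWeight Q (N + 1) := by
    intro M
    cases M with
    | zero => simpa using mul_nonneg hc' hK0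
    | succ M =>
      rw [Finset.sum_range_succ', add_comm]
      refine (norm_add_le _ _).trans (add_le_add ht_zero ?_)
      refine (norm_sum_le_of_le _ fun N _ => ht_pos (N + 1) (by omega)).trans ?_
      -- The shifted sum has one term fewer; the missing weight is nonnegative and may be added.
      rw [← Finset.mul_sum, Finset.sum_range_succ _ M]
      have := transientWeight_nonneg Q (M + 1)
      gcongr
      linarith
  have hlim : Tendsto (fun M : ℕ => (M : ℝ)⁻¹ * (c' * K) +
      c * K * ((M : ℝ)⁻¹ * ∑ N ∈ Finset.range M, transientWeight Q (N + 1))) atTop (𝓝 0) := by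
    simpa using ((tendsto_inv_atTop_nhds_zero_nat (𝕜 := ℝ)).mul_const (c' * K)).add
      ((tendsto_average_transientWeight Q).const_mul (c * K))
  refine squeeze_zero_norm (fun M => ?_) hlim
  rw [norm_mul, norm_inv, Complex.norm_natCast]
  refine (mul_le_mul_of_nonneg_left (hsum M) (by positivity)).trans (le_of_eq ?_)
  ring

end Transient

end RepeatedInteraction

theorem mainTheorem3 {Ω : Type*} [MeasurableSpace Ω] (μ : MeasureTheory.Measure Ω)
    [MeasureTheory.IsProbabilityMeasure μ] (d : ℕ) (Q : RepeatedInteraction.ERIS Ω μ d) :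
    -- the limit `𝔈(I)` that defines the recurrent projection exists almost surely
    (∀ᵐ ω ∂μ, Tendsto (fun M : ℕ => Q.cesaroAvgOne M ω) atTop (𝓝 (Q.cesaroLimitOne ω))) ∧
    -- decomposition of the recurrent projection
    (∃ (m : ℕ) (P : Fin m → Ω → RepeatedInteraction.Mat d),
      (∀ i, RepeatedInteraction.IsMinimalReducing Q (P i)) ∧
      (∀ i j, i ≠ j → ∀ᵐ ω ∂μ, P i ω * P j ω = 0 ∧ P j ω * P i ω = 0) ∧
      ∀ᵐ ω ∂μ, ∑ i, P i ω = Q.recurrentProj ω) ∧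
    -- the transient corner is left in the mean
    (∀ Y : Ω → RepeatedInteraction.Mat d, RepeatedInteraction.InCorner μ Q.transientProj Y →
      ∀ ϑ : Ω → RepeatedInteraction.Mat d, RepeatedInteraction.IsRandomState μ ϑ →
        Tendsto
          (fun M : ℕ => (M : ℂ)⁻¹ * ∑ N ∈ Finset.range M,
            ∫ ω, RepeatedInteraction.hsInner (Q.Phi N ω (ϑ ω)) (Y (Q.shift N ω)) ∂μ)
          atTop (𝓝 0)) := by
  exact ⟨Q.ae_tendsto_cesaroAvgOne,
    RepeatedInteraction.exists_minimalReducing_decomposition Q,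
    fun _ hY _ hϑ => RepeatedInteraction.tendsto_average_correlation_transient Q hY hϑ⟩
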